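/- Let $d\ge 2$ and let $\Omega\subset\mathbb R^d$ be a bounded, connected, nonempty open set with $\Omega=\operatorname{int}\overline\Omega$ (e.g. a connected bounded Lipschitz polytope). Let $\mathcal T$ be a conforming simplicial mesh of $\Omega$: a finite set of closed non-degenerate $d$-simplices with $\bigcup_{K\in\mathcal T}K=\overline\Omega$, any two of which meet exactly in the convex hull of their common vertices. Let $\mathcal V$ be the set of vertices and $\mathcal F$ the set of facets of the mesh, $\mathcal F_{\partial\Omega}=\{F\in\mathcal F: F\subset\partial\Omega\}$, $\mathcal F_\Omega=\mathcal F\setminus\mathcal F_{\partial\Omega}$, and let $k\ge 1$ be an integer. For a simplex $K$ with vertex set $\mathcal V(K)$ let $\lambda_{K,z}$ denote the barycentric coordinate of $K$ for the vertex $z$, and let $P_k^{(0,d-2)}$ be the Jacobi polynomial of degree $k$ (normalized by $P_k^{(0,d-2)}(1)=1$). In $L^2(\Omega)$ define, for $K\in\mathcal T$ and $F\in\mathcal F$, $$B_k^{CR,K}=\frac1d\Bigl(-1+\sum_{z\in\mathcal V(K)}P_k^{(0,d-2)}(1-2\lambda_{K,z})\Bigr)\ \text{on }K,\qquad B_k^{CR,K}=0\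 \text{elsewhere},$$ $$B_k^{CR,F}=P_k^{(0,d-2)}(1-2\lambda_{K,F})-B_k^{CR,K}\ \text{on every } K\in\mathcal T \text{ with } F\subset K,\qquad B_k^{CR,F}=0\ \text{elsewhere},$$ where $\lambda_{K,F}$ is the barycentric coordinate of $K$ for the vertex opposite to $F$. For $\mathcal T'\subset\mathcal T$ and $\mathcal F'\subset\mathcal F$ put $V_k^{nc}(\mathcal T')=\operatorname{span}\{B_k^{CR,K}:K\in\mathcal T'\}$ and $V_k^{nc}(\mathcal F')=\operatorname{span}\{B_k^{CR,F}:F\in\mathcal F'\}$. Let $S_k$ be the space of functions that are continuous on $\overline\Omega$ and polynomial of degree at most $k$ on every $K\in\mathcal T$, $S_{k,0}$ the subspace of functions with zero trace on $\partial\Omega$ (i.e. vanishing on $\partial\Omega$), and $S_k^\bullet$, $S_{k,0}^\bullet$ the subspaces of functions in $S_k$, $S_{k,0}$ that vanish at all vertices $z\in\mathcal V$. Define $$CR_k=\begin{cases}S_k+V_k^{nc}(\mathcal T)&k\text{ even}\\ S_k+V_k^{nc}(\mathcal F)&k\text{ odd}\end{cases}\qquad CR_{k,0}=\begin{cases}S_{k,0}+V_k^{nc}(\mathcal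 T)&k\text{ even}\\ S_{k,0}+V_k^{nc}(\mathcal F_\Omega)&k\text{ odd.}\end{cases}$$ Let $CR_k^{\max}$ be the set of those $v\in L^2(\Omega)$ that are polynomial of degree at most $k$ on the interior of every $K\in\mathcal T$ and whose jump across every $F\in\mathcal F_\Omega$ is $L^2(F)$-orthogonal to all polynomials of degree at most $k-1$; let $CR_{k,0}^{\max}$ be the set of those $v\in CR_k^{\max}$ whose restriction to every $F\in\mathcal F_{\partial\Omega}$ (the trace from the adjacent simplex) is also $L^2(F)$-orthogonal to all polynomials of degree at most $k-1$. Then the following hold. 1. If $k$ is odd, $CR_k=S_k^\bullet\oplus V_k^{nc}(\mathcal F)$ and $CR_{k,0}=S_{k,0}^\bullet\oplus V_k^{nc}(\mathcal F_\Omega)$. If $k$ is even, $CR_k=S_k\oplus V_k^{nc}(\mathcal T')$ for every $\mathcal T'\subset\mathcal T$ with $|\mathcal T'|=|\mathcal T|-1$, and $CR_{k,0}=S_{k,0}\oplus V_k^{nc}(\mathcal T)$. 2. If $k$ is odd, the family $(B_k^{CR,F})_{F\in\mathcal F}$ is a basis of $V_k^{nc}(\mathcal F)$ and $(B_k^{CR,F})_{F\in\mathcal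 F_\Omega}$ is a basis of $V_k^{nc}(\mathcal F_\Omega)$. If $k\ge2$, the family $(B_k^{CR,K})_{K\in\mathcal T}$ is a basis of $V_k^{nc}(\mathcal T)$. If $k=1$, $V_1^{nc}(\mathcal T)=\{0\}$. 3. $S_k\subset CR_k\subset CR_k^{\max}$ and $S_{k,0}\subset CR_{k,0}\subset CR_{k,0}^{\max}$. 4. The inclusion $S_{k,0}\subset CR_{k,0}$ is strict if $k$ is even, or if $k$ is odd and $\mathcal T$ consists of more than one simplex. The inclusion $CR_{k,0}\subset CR_{k,0}^{\max}$ is strict if $d=3$, $k\ge2$, and $k$ is odd or $\mathcal T$ consists of more than one simplex. -/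

import Mathlib

open MeasureTheory Set
open scoped ENNReal

noncomputable section

/-- The Euclidean space `ℝ^d`. -/
abbrev Euc (d : ℕ) : Type := EuclideanSpace ℝ (Fin d)

/-- The real Hilbert space `L²(Ω)` (classes of functions modulo equality almost everywhere). -/
abbrev L2 {d : ℕ} (Ω : Set (Euc d)) : Type :=
  Lp ℝ 2 (volume.restrict Ω : Measure (Euc d))

/-- The polynomial function on `ℝ^d` given by a polynomial in `d` variables. -/
def polyFun {d : ℕ} (p : MvPolynomial (Fin d) ℝ) (x : Euc d) : ℝ :=
  MvPolynomial.eval (fun i => x i) p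

/-- The Jacobi polynomial
`P_n^{(α,β)}(x) = ∑_{l ≤ n} (n+α+β+1)_l (α+l+1)_{n-l} / (l! (n-l)!) * ((x-1)/2)^l`,
where `(a)_m = a (a+1) ⋯ (a+m-1)`. -/
def jacobiPoly (α β : ℝ) (n : ℕ) : Polynomial ℝ :=
  ∑ l ∈ Finset.range (n + 1),
    Polynomial.C (((ascPochhammer ℝ l).eval (n + α + β + 1) *
        (ascPochhammer ℝ (n - l)).eval (α + l + 1)) /
          ((l.factorial : ℝ) * ((n - l).factorial : ℝ))) *
      (Polynomial.C (1 / 2 : ℝ) * (Polynomial.X - 1)) ^ l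

/-- A conforming simplicial finite element mesh of `Ω ⊆ ℝ^d`.  Each closed simplex is represented
by the finite set `K` of its `d+1` vertices; the simplex itself is `convexHull ℝ K`.  Any two
simplices meet exactly in the convex hull of their common vertices (a common face, or `∅`), and
the simplices cover `closure Ω`. -/
structure SimplicialMesh {d : ℕ} (Ω : Set (Euc d)) where
  cells : Finset (Finset (Euc d))
  card_eq : ∀ K ∈ cells, K.card = d + 1
  indep : ∀ K ∈ cells, AffineIndependent ℝ ((↑) : K → Euc d)
  conforming : ∀ K ∈ cells, ∀ K' ∈ cells,
    convexHull ℝ (K : Set (Euc d)) ∩ convexHull ℝ (K' : Set (Euc d)) =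
      convexHull ℝ ((K : Set (Euc d)) ∩ (K' : Set (Euc d)))
  cover : ⋃ K ∈ cells, convexHull ℝ (K : Set (Euc d)) = closure Ω

/-- A continuous function on a closed simplex, extended by zero, is square integrable. -/
theorem memLp_indicator_convexHull {d : ℕ} (Ω : Set (Euc d)) (K : Finset (Euc d))
    {g : Euc d → ℝ} (hg : Continuous g) :
    MemLp ((convexHull ℝ (K : Set (Euc d))).indicator g) 2 (volume.restrict Ω) := by
  have hK : IsCompact (convexHull ℝ (K : Set (Euc d))) := K.finite_toSet.isCompact_convexHull ℝ
  refine MemLp.restrict Ω ?_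
  rw [memLp_indicator_iff_restrict hK.measurableSet]
  obtain ⟨C, hC⟩ := hK.exists_bound_of_continuousOn hg.continuousOn
  have : IsFiniteMeasure (volume.restrict (convexHull ℝ (K : Set (Euc d)))) :=
    ⟨by simpa using hK.measure_lt_top⟩
  exact MemLp.of_bound hg.aestronglyMeasurable C
    ((ae_restrict_iff' hK.measurableSet).2 (Filter.Eventually.of_forall hC))

namespace SimplicialMesh

variable {d : ℕ} {Ω : Set (Euc d)} (T : SimplicialMesh Ω)

/-- The vertices of a cell form an affine basis of `ℝ^d`. -/
def affineBasis (K : T.cells) : AffineBasis K.1 ℝ (Euc d) where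
  toFun := (↑)
  ind' := T.indep K.1 K.2
  tot' := by
    rw [(T.indep K.1 K.2).affineSpan_eq_top_iff_card_eq_finrank_add_one]
    simp [T.card_eq K.1 K.2]

/-- The barycentric coordinate `λ_{K,z}` of the cell `K` for its vertex `z`: the affine function
with value `1` at `z` and `0` at the other vertices of `K`. -/
def bary (K : T.cells) (z : K.1) (x : Euc d) : ℝ :=
  (T.affineBasis K).coord z x

theorem continuous_bary (K : T.cells) (z : K.1) : Continuous (T.bary K z) :=
  ((T.affineBasis K).coord z).continuous_of_finiteDimensional

open Classical in
/-- The vertices of the mesh. -/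
def vertices : Finset (Euc d) := T.cells.biUnion id

open Classical in
/-- The facets of the mesh; a facet is represented by the set of its `d` vertices. -/
def facets : Finset (Finset (Euc d)) := T.cells.biUnion fun K => K.powersetCard d

open Classical in
/-- The interior facets: those that are not contained in the boundary of `Ω`. -/
def interiorFacets : Finset (Finset (Euc d)) :=
  T.facets.filter fun F => ¬ convexHull ℝ (F : Set (Euc d)) ⊆ frontier Ω

open Classical in
/-- The boundary facets: those that are contained in the boundary of `Ω`. -/
def boundaryFacets : Finset (Finset (Euc d)) :=
  T.facets.filter fun F => convexHull ℝ (F : Set (Euc d)) ⊆ frontier Ω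

/-- The function `P_k^{(0,d-2)}(1 - 2 λ_{K,z})`. -/
def jacobiBary (k : ℕ) (K : T.cells) (z : K.1) (x : Euc d) : ℝ :=
  (jacobiPoly 0 ((d : ℝ) - 2) k).eval (1 - 2 * T.bary K z x)

theorem continuous_jacobiBary (k : ℕ) (K : T.cells) (z : K.1) :
    Continuous (T.jacobiBary k K z) :=
  (Polynomial.continuous _).comp
    (continuous_const.sub (continuous_const.mul (T.continuous_bary K z)))

/-- The polynomial `(1/d) (-1 + ∑_z P_k^{(0,d-2)}(1 - 2 λ_{K,z}))`, which gives the
non-conforming simplex function on `K`. -/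
def cellShape (k : ℕ) (K : T.cells) (x : Euc d) : ℝ :=
  1 / (d : ℝ) * (-1 + ∑ z : K.1, T.jacobiBary k K z x)

theorem continuous_cellShape (k : ℕ) (K : T.cells) : Continuous (T.cellShape k K) :=
  continuous_const.mul (continuous_const.add
    (continuous_finsetSum _ fun z _ => T.continuous_jacobiBary k K z))

open Classical in
/-- The polynomial `P_k^{(0,d-2)}(1 - 2 λ_{K,F}) - B_k^{CR,K}` for a facet `F` of `K`.  The only
non-zero term of the sum belongs to the vertex of `K` that is not in `F`, i.e. is opposite to `F`. -/
def facetShape (k : ℕ) (F : Finset (Euc d)) (K : T.cells) (x : Euc d) : ℝ :=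
  (∑ z : K.1, if (z : Euc d) ∈ F then 0 else T.jacobiBary k K z x) - T.cellShape k K x

theorem continuous_facetShape (k : ℕ) (F : Finset (Euc d)) (K : T.cells) :
    Continuous (T.facetShape k F K) :=
  Continuous.sub (continuous_finsetSum _ fun z _ => by
    split_ifs
    exacts [continuous_const, T.continuous_jacobiBary k K z]) (T.continuous_cellShape k K)

/-- The non-conforming simplex function `B_k^{CR,K}`, as an element of `L²(Ω)`. -/
def cellFun (k : ℕ) (K : T.cells) : L2 Ω :=
  (memLp_indicator_convexHull Ω K.1 (T.continuous_cellShape k K)).toLp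

open Classical in
/-- The non-conforming facet function `B_k^{CR,F}`, as an element of `L²(Ω)`: on every cell `K`
adjacent to `F` it is `P_k^{(0,d-2)}(1 - 2 λ_{K,F}) - B_k^{CR,K}`, and it vanishes elsewhere. -/
def facetFun (k : ℕ) (F : Finset (Euc d)) : L2 Ω :=
  ∑ K : T.cells with F ⊆ K.1,
    (memLp_indicator_convexHull Ω K.1 (T.continuous_facetShape k F K)).toLp

/-- `V_k^{nc}(T')`: the span of the simplex functions of the cells in `T'`. -/
def Vcell (k : ℕ) (T' : Set T.cells) : Submodule ℝ (L2 Ω) :=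
  Submodule.span ℝ (T.cellFun k '' T')

/-- `V_k^{nc}(A)`: the span of the facet functions of the facets in `A`. -/
def Vfacet (k : ℕ) (A : Finset (Finset (Euc d))) : Submodule ℝ (L2 Ω) :=
  Submodule.span ℝ (T.facetFun k '' (A : Set (Finset (Euc d))))

/-- `u` is a representative of `v ∈ L²(Ω)` that is continuous on `closure Ω` and, on every closed
cell, a polynomial of degree at most `k`. -/
def IsConformingRep (k : ℕ) (v : L2 Ω) (u : Euc d → ℝ) : Prop :=
  ContinuousOn u (closure Ω) ∧ v =ᵐ[volume.restrict Ω] u ∧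
    ∀ K ∈ T.cells, ∃ p : MvPolynomial (Fin d) ℝ, p.totalDegree ≤ k ∧
      EqOn u (polyFun p) (convexHull ℝ (K : Set (Euc d)))

theorem isConformingRep_zero (k : ℕ) : T.IsConformingRep k 0 0 :=
  ⟨continuousOn_const, Lp.coeFn_zero _ _ _,
    fun _ _ => ⟨0, by simp, fun x _ => by simp [polyFun]⟩⟩

theorem IsConformingRep.add {T : SimplicialMesh Ω} {k : ℕ} {v w : L2 Ω} {f g : Euc d → ℝ}
    (hf : T.IsConformingRep k v f) (hg : T.IsConformingRep k w g) :
    T.IsConformingRep k (v + w) (f + g) := by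
  refine ⟨hf.1.add hg.1, (Lp.coeFn_add v w).trans (hf.2.1.add hg.2.1), fun K hK => ?_⟩
  obtain ⟨p, hp, hp'⟩ := hf.2.2 K hK
  obtain ⟨q, hq, hq'⟩ := hg.2.2 K hK
  refine ⟨p + q, (MvPolynomial.totalDegree_add p q).trans (max_le hp hq), fun x hx => ?_⟩
  simp [polyFun, hp' hx, hq' hx]

theorem IsConformingRep.smul {T : SimplicialMesh Ω} {k : ℕ} {v : L2 Ω} {f : Euc d → ℝ}
    (hf : T.IsConformingRep k v f) (c : ℝ) : T.IsConformingRep k (c • v) (c • f) := by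
  refine ⟨hf.1.const_smul c, (Lp.coeFn_smul c v).trans (hf.2.1.const_smul c), fun K hK => ?_⟩
  obtain ⟨p, hp, hp'⟩ := hf.2.2 K hK
  refine ⟨c • p, (MvPolynomial.totalDegree_smul_le c p).trans hp, fun x hx => ?_⟩
  simp [polyFun, hp' hx, MvPolynomial.smul_eval]

/-- The conforming functions of degree `k` whose continuous representative vanishes on `Z`. -/
def conformingVanishing (k : ℕ) (Z : Set (Euc d)) : Submodule ℝ (L2 Ω) where
  carrier := {v | ∃ u : Euc d → ℝ, T.IsConformingRep k v u ∧ ∀ x ∈ Z, u x = 0}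
  zero_mem' := ⟨0, T.isConformingRep_zero k, fun _ _ => rfl⟩
  add_mem' := by
    rintro v w ⟨f, hf, hf'⟩ ⟨g, hg, hg'⟩
    exact ⟨f + g, hf.add hg, fun x hx => by simp [hf' x hx, hg' x hx]⟩
  smul_mem' := by
    rintro c v ⟨f, hf, hf'⟩
    exact ⟨c • f, hf.smul c, fun x hx => by simp [hf' x hx]⟩

/-- `S_k(T)`: globally continuous functions that are piecewise polynomial of degree at most `k`. -/
def S (k : ℕ) : Submodule ℝ (L2 Ω) := T.conformingVanishing k ∅

/-- `S_{k,0}(T)`: the functions in `S_k(T)` with zero trace on the boundary of `Ω`. -/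
def S0 (k : ℕ) : Submodule ℝ (L2 Ω) := T.conformingVanishing k (frontier Ω)

/-- `S•_k(T)`: the functions in `S_k(T)` that vanish at all vertices of the mesh. -/
def Sdot (k : ℕ) : Submodule ℝ (L2 Ω) := T.conformingVanishing k (T.vertices : Set (Euc d))

/-- `S•_{k,0}(T)`: the functions in `S_{k,0}(T)` that vanish at all vertices of the mesh. -/
def S0dot (k : ℕ) : Submodule ℝ (L2 Ω) :=
  T.conformingVanishing k (frontier Ω ∪ (T.vertices : Set (Euc d)))

/-- `g` is the restriction of `v ∈ L²(Ω)` to the closed simplex `K`: it agrees with `v` on the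
interior of `K` and is continuous up to the boundary of `K`. -/
def IsRestriction (v : L2 Ω) (K : Finset (Euc d)) (g : Euc d → ℝ) : Prop :=
  ContinuousOn g (convexHull ℝ (K : Set (Euc d))) ∧
    v =ᵐ[(volume.restrict Ω).restrict (interior (convexHull ℝ (K : Set (Euc d))))] g

/-- `ℙ_k(T)`: the discontinuous piecewise polynomials of degree at most `k`. -/
def brokenPoly (k : ℕ) : Set (L2 Ω) :=
  {v | ∀ K ∈ T.cells, ∃ p : MvPolynomial (Fin d) ℝ, p.totalDegree ≤ k ∧
    IsRestriction v K (polyFun p)}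

/-- `g` is `L²`-orthogonal on the facet `F` to all polynomials of degree less than `k`, with
respect to the `(d-1)`-dimensional surface measure. -/
def FacetOrth (k : ℕ) (F : Finset (Euc d)) (g : Euc d → ℝ) : Prop :=
  ∀ q : MvPolynomial (Fin d) ℝ, q.totalDegree < k →
    ∫ x in convexHull ℝ (F : Set (Euc d)), g x * polyFun q x
      ∂(Measure.euclideanHausdorffMeasure (d - 1)) = 0

/-- `CR_k^max(T)`: the piecewise polynomials of degree at most `k` whose jumps across the interior
facets are orthogonal to polynomials of degree at most `k-1`. -/
def CRmax (k : ℕ) : Set (L2 Ω) :=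
  {v | v ∈ T.brokenPoly k ∧ ∀ F ∈ T.interiorFacets, ∀ K ∈ T.cells, ∀ K' ∈ T.cells,
    F ⊆ K → F ⊆ K' → K ≠ K' → ∀ g g' : Euc d → ℝ,
      IsRestriction v K g → IsRestriction v K' g' → FacetOrth k F (g - g')}

/-- `CR_{k,0}^max(T)`: the functions in `CR_k^max(T)` whose restrictions to the boundary facets are
orthogonal to polynomials of degree at most `k-1`. -/
def CR0max (k : ℕ) : Set (L2 Ω) :=
  {v | v ∈ T.CRmax k ∧ ∀ F ∈ T.boundaryFacets, ∀ K ∈ T.cells, F ⊆ K → ∀ g : Euc d → ℝ,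
    IsRestriction v K g → FacetOrth k F g}

open Classical in
/-- The canonical Crouzeix-Raviart space `CR_k(T)`. -/
def CR (k : ℕ) : Submodule ℝ (L2 Ω) :=
  if Even k then T.S k ⊔ T.Vcell k univ else T.S k ⊔ T.Vfacet k T.facets

open Classical in
/-- The canonical Crouzeix-Raviart space `CR_{k,0}(T)` with zero boundary conditions. -/
def CR0 (k : ℕ) : Submodule ℝ (L2 Ω) :=
  if Even k then T.S0 k ⊔ T.Vcell k univ else T.S0 k ⊔ T.Vfacet k T.interiorFacets

end SimplicialMesh

end

/-- The family `b` of vectors, indexed by `ι`, is a basis of the subspace `V`. -/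
def IsBasisOf {ι E : Type*} [AddCommGroup E] [Module ℝ E] (b : ι → E)
    (V : Submodule ℝ E) : Prop :=
  LinearIndependent ℝ b ∧ Submodule.span ℝ (Set.range b) = V

/-! Write f(s) = P_k^{(0,d-2)}(1 - 2s) and J = f(1). Then f(0) = 1 and J = (-1)^k C(k+d-2, d-2). The
theorem rests on orthogonality of f along facets, on values at vertices, and on two identities that
produce conforming functions.

Orthogonality: let z be a vertex of a facet F, a simplex of dimension d - 1. Integrating along the
segments from z to the opposite face of F produces the weight (1-s)^(d-2) with s = λ_z, which is the
Jacobi weight. Hence f(λ_z) is orthogonal on F to all polynomials of degree less than k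
(`facetOrth_jacobiBary`). For the vertex opposite to F the coordinate is 0 on F and f equals 1
there. So every conforming, simplex or facet function has on F a trace that is the same from all
adjacent cells, up to a combination of such orthogonal functions (`HasFacetTraces`). This gives the
inclusions in the maximal spaces.

Vertex values: B_K equals (d-1+J)/d at every vertex of K. On an adjacent cell, B_F equals (1-J)/d at
the vertices of F and (1-J)(1-d)/d at the opposite vertex. If J ≠ 1 these values determine the
coefficients of a combination of facet functions (`coeff_eq_zero_of_vertex`); if d-1+J ≠ 0, a
conforming combination of simplex functions has the same coefficient on cells with a common vertex,
hence on all cells because Ω is connected (`cellSum_coeff_eq`). Odd k gives J < 0 and even k gives J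
> 0, which settles the direct sums.

Identities: the B_F with z in F add up to 1 - f(φ_z), where φ_z is the hat function
(`isRestriction_psiL2`), and the sum of all B_K is 1 - (1/d) Σ_z (1 - f(φ_z)) (`sum_cellFun_mem_S`).
The first one corrects the vertex values of a conforming function inside the span of the facet
functions; the second makes one simplex function redundant modulo S_k.

Strictness comes from vertex values again. In dimension 3, where J = (-1)^k (k+1), the second
inclusion is strict because the family not used for the given parity has members in the maximal
space but outside CR_{k,0}. The geometric input is `mem_of_support_le`, which uses Ω = int closure
Ω: a facet not contained in the boundary has a second adjacent cell. -/

/-! ### Jacobi polynomials on the unit interval. -/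

/-- Values of the Jacobi polynomial `P_k^{(0,m)}` as a binomial sum. -/
theorem jacobiPoly_eval_one_sub (m k : ℕ) (s : ℝ) :
    (jacobiPoly 0 m k).eval (1 - 2 * s) =
      ∑ l ∈ Finset.range (k + 1), ((k.choose l : ℝ) * ((k + m + l).choose l : ℝ)) * (-s) ^ l := by
  have hP (n l : ℕ) : (ascPochhammer ℝ l).eval ((n : ℝ) + 1) =
      ((n + l).factorial : ℝ) / n.factorial := by
    rw [eq_div_iff (by positivity), mul_comm]
    have := Nat.factorial_mul_ascFactorial n l
    rw [← ascPochhammer_nat_eq_ascFactorial] at this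
    have h2 := ascPochhammer_eval_cast (S := ℝ) l (n + 1)
    push_cast at h2
    rw [← h2]
    exact_mod_cast this
  simp only [jacobiPoly, Polynomial.eval_finsetSum]
  refine Finset.sum_congr rfl fun l hl => ?_
  have hl' : l ≤ k := Nat.lt_succ_iff.1 (Finset.mem_range.1 hl)
  have h1 : (k : ℝ) + 0 + m + 1 = ((k + m : ℕ) : ℝ) + 1 := by push_cast; ring
  rw [h1, hP, zero_add, hP, Nat.cast_choose ℝ hl', Nat.cast_choose ℝ (Nat.le_add_left l (k + m)),
    Nat.add_sub_cancel_right, Nat.add_sub_cancel' hl']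
  simp only [Polynomial.eval_mul, Polynomial.eval_C, Polynomial.eval_pow, Polynomial.eval_sub,
    Polynomial.eval_X, Polynomial.eval_one]
  have : (1 / 2 : ℝ) * (1 - 2 * s - 1) = -s := by ring
  rw [this]
  field_simp

theorem jacobiPoly_eval_one (m k : ℕ) : (jacobiPoly 0 m k).eval 1 = 1 := by
  have := jacobiPoly_eval_one_sub m k 0
  rw [Finset.sum_eq_single_of_mem 0 (by simp) (fun l _ hl => by simp [hl])] at this
  simpa using this

theorem sum_neg_one_pow_mul_choose_mul_eq (k : ℕ) (f : ℕ → ℝ) :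
    ∑ l ∈ Finset.range (k + 1), (-1 : ℝ) ^ l * k.choose l * f l =
      (-1) ^ k * (fwdDiff 1)^[k] f 0 := by
  rw [fwdDiff_iter_eq_sum_shift, Finset.mul_sum]
  refine Finset.sum_congr rfl fun l hl => ?_
  have hl' : l ≤ k := Nat.lt_succ_iff.1 (Finset.mem_range.1 hl)
  obtain ⟨j, rfl⟩ := Nat.exists_eq_add_of_le hl'
  have : ((-1 : ℝ) ^ j) * (-1) ^ j = 1 := by rw [← mul_pow]; simp
  simp only [Nat.add_sub_cancel_left, zero_add, smul_eq_mul, mul_one, zsmul_eq_mul]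
  push_cast
  rw [pow_add]
  linear_combination -(-1 : ℝ) ^ l * ((l + j).choose l : ℝ) * f l * this

/-- The alternating binomial sum at s = 1 is, up to the sign (-1)^k, the k-th difference at 0 of the
function l ↦ C(l+k+m, k+m). Each difference lowers the lower index by one, which leaves C(k+m, m).
-/
theorem jacobiPoly_eval_neg_one (m k : ℕ) :
    (jacobiPoly 0 m k).eval (-1) = (-1) ^ k * ((k + m).choose m : ℝ) := by
  have h := jacobiPoly_eval_one_sub m k 1
  have h1 : (1 : ℝ) - 2 * 1 = -1 := by norm_num
  rw [h1] at h
  rw [h]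
  have h2 := fwdDiff_iter_comp_add (1 : ℕ) (fun x ↦ x.choose (k + m) : ℕ → ℤ) (k + m) k 0
  rw [fwdDiff_iter_choose, fwdDiff_iter_eq_sum_shift] at h2
  have h3 := sum_neg_one_pow_mul_choose_mul_eq k (fun l => ((l + (k + m)).choose (k + m) : ℝ))
  rw [fwdDiff_iter_eq_sum_shift] at h3
  have h4 : ∑ l ∈ Finset.range (k + 1), ((-1 : ℤ) ^ (k - l) * (k.choose l : ℤ)) •
      (((0 + l • 1 + (k + m)).choose (k + m) : ℕ) : ℝ) = ((k + m).choose m : ℝ) := by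
    have := congrArg (fun z : ℤ => (z : ℝ)) h2
    simpa using this
  rw [h4] at h3
  rw [← h3]
  refine Finset.sum_congr rfl fun l _ => ?_
  rw [Nat.add_comm l (k + m), ← Nat.choose_symm_add]
  ring

/-- The function s^(l+1) (1-s)^(j+1) vanishes at both ends of the interval, so its derivative
integrates to zero. This trades a power of s for a power of 1 - s, so the induction on l needs the
claim for all j. -/
theorem integral_pow_mul_one_sub_pow (l : ℕ) : ∀ j : ℕ,
    ∫ s in (0 : ℝ)..1, s ^ l * (1 - s) ^ j =
      (l.factorial * j.factorial : ℝ) / (l + j + 1).factorial := by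
  induction l with
  | zero =>
    intro j
    have : ∫ s in (0 : ℝ)..1, (1 - s) ^ j = 1 / (j + 1) := by
      rw [intervalIntegral.integral_comp_sub_left (fun s => s ^ j) 1]
      simp
    simp only [pow_zero, one_mul, this, zero_add, Nat.factorial_zero, Nat.factorial_succ]
    push_cast
    field_simp
  | succ l ih =>
    intro j
    have hd (s : ℝ) : HasDerivAt (fun s : ℝ => s ^ (l + 1) * (1 - s) ^ (j + 1))
        ((l + 1) * (s ^ l * (1 - s) ^ (j + 1)) - (j + 1) * (s ^ (l + 1) * (1 - s) ^ j)) s := by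
      have h1 := (hasDerivAt_id s).pow (l + 1)
      have h2 := ((hasDerivAt_id s).const_sub 1).pow (j + 1)
      refine (h1.mul h2).congr_deriv ?_
      simp only [id, Nat.add_sub_cancel, Pi.pow_apply]
      push_cast
      ring
    have h := intervalIntegral.integral_eq_sub_of_hasDerivAt (a := 0) (b := 1)
      (fun s _ => hd s) (Continuous.intervalIntegrable (by fun_prop) _ _)
    rw [intervalIntegral.integral_sub (Continuous.intervalIntegrable (by fun_prop) _ _)
      (Continuous.intervalIntegrable (by fun_prop) _ _), intervalIntegral.integral_const_mul,
      intervalIntegral.integral_const_mul, ih] at h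
    have e : (l + (j + 1) + 1).factorial = (l + 1 + j + 1).factorial := by congr 1; ring
    rw [e] at h
    have hj : (j + 1 : ℝ) ≠ 0 := by positivity
    apply mul_left_cancel₀ hj
    simp only [Nat.factorial_succ] at h ⊢
    simp at h
    push_cast at h ⊢
    linear_combination -h

theorem integral_jacobiPoly_mul_pow_eq_zero (m : ℕ) {k j : ℕ} (hj : j < k) :
    ∫ s in (0 : ℝ)..1, (jacobiPoly 0 m k).eval (1 - 2 * s) * (1 - s) ^ (m + j) = 0 := by
  simp only [jacobiPoly_eval_one_sub, Finset.sum_mul]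
  rw [intervalIntegral.integral_finsetSum
    (fun l _ => Continuous.intervalIntegrable (by fun_prop) _ _)]
  obtain ⟨i, rfl⟩ : ∃ i, k = j + 1 + i := Nat.exists_eq_add_of_le hj
  set k := j + 1 + i with hk
  -- After the beta integrals, the l-th term is a constant times (-1)^l C(k,l) p(l) with p(l) =
  -- (k+m+l)! / (l+m+j+1)!. This is a product of i = k-1-j consecutive factors beginning with
  -- l+m+j+2, so p has degree i < k and its k-th difference vanishes.
  let p : Polynomial ℝ := (ascPochhammer ℝ i).comp (Polynomial.X + Polynomial.C (m + j + 2 : ℝ))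
  have hp : p.natDegree < k := by
    rw [Polynomial.natDegree_comp, Polynomial.natDegree_X_add_C, ascPochhammer_natDegree]
    omega
  have h0 : (fwdDiff (1 : ℕ))^[k] (fun l : ℕ => p.eval (l : ℝ)) 0 = 0 := by
    have := congrFun (Polynomial.fwdDiff_iter_eq_zero_of_degree_lt hp) 0
    rw [fwdDiff_iter_eq_sum_shift] at this ⊢
    simpa using this
  have h1 := sum_neg_one_pow_mul_choose_mul_eq k (fun l : ℕ => p.eval (l : ℝ))
  rw [h0, mul_zero] at h1
  have h2 := congrArg (fun x => x * (((m + j).factorial : ℝ) / (k + m).factorial)) h1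
  simp only [zero_mul, Finset.sum_mul] at h2
  refine Eq.trans ?_ h2
  refine Finset.sum_congr rfl fun l _ => ?_
  have e1 : ∀ s : ℝ, (k.choose l : ℝ) * ((k + m + l).choose l : ℝ) * (-s) ^ l * (1 - s) ^ (m + j) =
      ((k.choose l : ℝ) * ((k + m + l).choose l : ℝ) * (-1) ^ l) * (s ^ l * (1 - s) ^ (m + j)) := by
    intro s
    rw [neg_pow]
    ring
  simp only [e1]
  rw [intervalIntegral.integral_const_mul, integral_pow_mul_one_sub_pow,
    Nat.cast_choose ℝ (Nat.le_add_left l (k + m)), Nat.add_sub_cancel_right]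
  have e2 : p.eval (l : ℝ) = ((k + m + l).factorial : ℝ) / (l + (m + j) + 1).factorial := by
    rw [eq_div_iff (by positivity), mul_comm]
    have := Nat.factorial_mul_ascFactorial (l + (m + j) + 1) i
    rw [← ascPochhammer_nat_eq_ascFactorial] at this
    have h2 := ascPochhammer_eval_cast (S := ℝ) i (l + (m + j) + 1 + 1)
    have e3 : p.eval (l : ℝ) = (ascPochhammer ℝ i).eval (((l + (m + j) + 1 + 1 : ℕ) : ℝ)) := by
      simp only [p, Polynomial.eval_comp, Polynomial.eval_add, Polynomial.eval_X,
        Polynomial.eval_C]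
      congr 1
      push_cast
      ring
    have e4 : l + (m + j) + 1 + i = k + m + l := by omega
    rw [e4] at this
    rw [e3, ← h2]
    exact_mod_cast this
  rw [e2]
  field_simp

/-- Orthogonality of the Jacobi polynomials on `[0, 1]`. -/
theorem integral_jacobiPoly_mul_eq_zero (m : ℕ) {k : ℕ} (Q : Polynomial ℝ)
    (hQ : Q.natDegree < k) :
    ∫ s in (0 : ℝ)..1, (jacobiPoly 0 m k).eval (1 - 2 * s) * (1 - s) ^ m * Q.eval s = 0 := by
  -- In powers of 1 - s instead of s, every term of Q merges with the weight (1-s)^m.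
  let R : Polynomial ℝ := Q.comp (1 - Polynomial.X)
  have hR : R.natDegree < k := by
    have h1 : (1 - Polynomial.X : Polynomial ℝ).natDegree ≤ 1 := by
      refine (Polynomial.natDegree_sub_le _ _).trans ?_
      simp
    calc R.natDegree ≤ Q.natDegree * (1 - Polynomial.X : Polynomial ℝ).natDegree :=
          Polynomial.natDegree_comp_le
      _ ≤ Q.natDegree * 1 := Nat.mul_le_mul_left _ h1
      _ < k := by simpa using hQ
  have hQR (s : ℝ) : Q.eval s = ∑ j ∈ Finset.range k, R.coeff j * (1 - s) ^ j := by
    rw [← Polynomial.eval_eq_sum_range' hR]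
    simp [R, Polynomial.eval_comp]
  simp only [hQR, Finset.mul_sum]
  rw [intervalIntegral.integral_finsetSum
    (fun l _ => Continuous.intervalIntegrable (by
      have := (jacobiPoly 0 m k).continuous
      fun_prop) _ _)]
  refine Finset.sum_eq_zero fun j hj => ?_
  have e : ∀ s : ℝ, (jacobiPoly 0 m k).eval (1 - 2 * s) * (1 - s) ^ m * (R.coeff j * (1 - s) ^ j) =
      R.coeff j * ((jacobiPoly 0 m k).eval (1 - 2 * s) * (1 - s) ^ (m + j)) := by
    intro s; ring
  simp only [e]
  rw [intervalIntegral.integral_const_mul,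
    integral_jacobiPoly_mul_pow_eq_zero m (Finset.mem_range.1 hj), mul_zero]

theorem jacobiPoly_eval_neg_one_pos (m : ℕ) {k : ℕ} (hk : Even k) :
    0 < (jacobiPoly 0 m k).eval (-1) := by
  rw [jacobiPoly_eval_neg_one, hk.neg_one_pow, one_mul]
  exact_mod_cast Nat.choose_pos (Nat.le_add_left m k)

theorem jacobiPoly_eval_neg_one_neg (m : ℕ) {k : ℕ} (hk : Odd k) :
    (jacobiPoly 0 m k).eval (-1) < 0 := by
  rw [jacobiPoly_eval_neg_one, hk.neg_one_pow, neg_one_mul, neg_lt_zero]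
  exact_mod_cast Nat.choose_pos (Nat.le_add_left m k)

/-- For `k ≥ 2` the function `s ↦ P_k^{(0,m)}(1 - 2s)` is not affine on `[0, 1]`. -/
theorem exists_jacobiPoly_not_affine (m : ℕ) {k : ℕ} (hk : 2 ≤ k) :
    ∃ a ∈ Icc (0 : ℝ) (1 / 2), (jacobiPoly 0 m k).eval (1 - 2 * (2 * a)) + 1 ≠
      2 * (jacobiPoly 0 m k).eval (1 - 2 * a) := by
  by_contra! h
  let c : ℕ → ℝ := fun l => (k.choose l : ℝ) * ((k + m + l).choose l : ℝ)
  -- With f(s) for the Jacobi polynomial at 1 - 2s, this is r(a) = f(2a) + 1 - 2 f(a). Its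
  -- coefficient of a^k contains the factor 2^k - 2, nonzero for k ≥ 2. The summand 1 cancels the
  -- constant term and so would make r vanish for affine f.
  let r : Polynomial ℝ := (∑ l ∈ Finset.range (k + 1),
    Polynomial.C (c l * (-1) ^ l * (2 ^ l - 2)) * Polynomial.X ^ l) + Polynomial.C 1
  have hr : r = 0 := by
    refine Polynomial.eq_zero_of_infinite_isRoot r ((Icc_infinite (by norm_num)).mono
      (s := Icc (0 : ℝ) (1 / 2)) fun a ha => ?_)
    have h1 := h a ha
    rw [jacobiPoly_eval_one_sub, jacobiPoly_eval_one_sub, ← sub_eq_zero] at h1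
    change r.eval a = 0
    rw [← h1]
    simp only [r, c, Polynomial.eval_add, Polynomial.eval_finsetSum, Polynomial.eval_mul,
      Polynomial.eval_C, Polynomial.eval_pow, Polynomial.eval_X, Finset.mul_sum]
    rw [add_sub_right_comm, ← Finset.sum_sub_distrib]
    congr 1
    refine Finset.sum_congr rfl fun l _ => ?_
    rw [neg_pow (2 * a), neg_pow a, mul_pow]
    ring
  have hc : r.coeff k = c k * (-1) ^ k * (2 ^ k - 2) := by
    simp only [r, Polynomial.coeff_add, Polynomial.finsetSum_coeff, Polynomial.coeff_C_mul,
      Polynomial.coeff_X_pow, Polynomial.coeff_C]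
    simp [show k ≠ 0 by omega]
  rw [hr, Polynomial.coeff_zero] at hc
  have h1 : c k ≠ 0 := by
    have := Nat.choose_pos (Nat.le_add_left k (k + m))
    simp only [c, Nat.choose_self, Nat.cast_one, one_mul]
    exact_mod_cast this.ne'
  have h2 : (2 : ℝ) ^ 2 ≤ 2 ^ k := pow_le_pow_right₀ (by norm_num) hk
  have h3 : (2 : ℝ) ^ k - 2 ≠ 0 := by
    norm_num at h2
    linarith
  exact mul_ne_zero (mul_ne_zero h1 (by simp)) h3 hc.symm

/-! ### Integration over simplices and orthogonality in a barycentric coordinate. -/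

/-- The corner simplex `{t | 0 ≤ t, ∑ t_i ≤ 1}` of `ℝ^n`. -/
def cornerSimplex (n : ℕ) : Set (Fin n → ℝ) := {t | (∀ i, 0 ≤ t i) ∧ ∑ i, t i ≤ 1}

theorem isCompact_cornerSimplex (n : ℕ) : IsCompact (cornerSimplex n) := by
  refine (isCompact_Icc (a := (0 : Fin n → ℝ)) (b := 1)).of_isClosed_subset ?_ ?_
  · have h1 : IsClosed {t : Fin n → ℝ | ∀ i, 0 ≤ t i} := by
      simp only [ofPred_forall]
      exact isClosed_iInter fun i => isClosed_le continuous_const (continuous_apply i)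
    exact h1.inter (isClosed_le (continuous_finsetSum _ fun i _ => continuous_apply i) continuous_const)
  · intro t ht
    exact ⟨fun i => ht.1 i, fun i =>
      (Finset.single_le_sum (fun j _ => ht.1 j) (Finset.mem_univ i)).trans ht.2⟩

theorem convex_cornerSimplex (n : ℕ) : Convex ℝ (cornerSimplex n) := by
  intro s hs t ht a b ha hb hab
  refine ⟨fun i => ?_, ?_⟩
  · have := hs.1 i
    have := ht.1 i
    simp only [Pi.add_apply, Pi.smul_apply, smul_eq_mul]
    positivity
  · simp only [Pi.add_apply, Pi.smul_apply, smul_eq_mul, Finset.sum_add_distrib, ← Finset.mul_sum]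
    have h1 := mul_le_mul_of_nonneg_left hs.2 ha
    have h2 := mul_le_mul_of_nonneg_left ht.2 hb
    linarith

theorem cons_mem_cornerSimplex {m : ℕ} {s : ℝ} {y : Fin m → ℝ} :
    (Fin.cons s y : Fin (m + 1) → ℝ) ∈ cornerSimplex (m + 1) ↔
      0 ≤ s ∧ (∀ i, 0 ≤ y i) ∧ s + ∑ i, y i ≤ 1 := by
  simp [cornerSimplex, Fin.forall_fin_succ, Fin.sum_univ_succ, and_assoc]

open scoped Pointwise in
theorem cons_mem_cornerSimplex_iff_mem_smul {m : ℕ} {s : ℝ} (h0 : 0 ≤ s) (h1 : s < 1)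
    {y : Fin m → ℝ} : (Fin.cons s y : Fin (m + 1) → ℝ) ∈ cornerSimplex (m + 1) ↔
      y ∈ (1 - s) • cornerSimplex m := by
  have hs : 0 < 1 - s := sub_pos.2 h1
  rw [cons_mem_cornerSimplex, Set.mem_smul_set_iff_inv_smul_mem₀ hs.ne']
  simp only [cornerSimplex, mem_ofPred_eq, Pi.smul_apply, smul_eq_mul, ← Finset.mul_sum]
  have e1 (i : Fin m) : 0 ≤ (1 - s)⁻¹ * y i ↔ 0 ≤ y i := by
    rw [mul_nonneg_iff_of_pos_left (inv_pos.2 hs)]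
  rw [inv_mul_le_iff₀ hs, mul_one]
  simp only [e1]
  constructor
  · rintro ⟨_, a, b⟩
    exact ⟨a, by linarith⟩
  · rintro ⟨a, b⟩
    exact ⟨h0, a, by linarith⟩

open scoped Pointwise in
/-- A continuous function whose weighted integrals over the rays through a vertex vanish has
integral zero over the simplex. -/
theorem setIntegral_cornerSimplex_eq_zero {m : ℕ} {h : (Fin (m + 1) → ℝ) → ℝ} (hc : Continuous h)
    (hz : ∀ y ∈ cornerSimplex m,
      ∫ s in (0 : ℝ)..1, (1 - s) ^ m * h (Fin.cons s ((1 - s) • y)) = 0) :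
    ∫ t in cornerSimplex (m + 1), h t = 0 := by
  have hcons : Continuous fun p : ℝ × (Fin m → ℝ) => (Fin.cons p.1 p.2 : Fin (m + 1) → ℝ) :=
    continuous_pi fun i => by
      refine Fin.cases ?_ (fun j => ?_) i
      · simpa using continuous_fst
      · simp only [Fin.cons_succ]
        fun_prop
  have hM := (isCompact_cornerSimplex (m + 1)).measurableSet
  have hint : Integrable ((cornerSimplex (m + 1)).indicator h) :=
    (integrable_indicator_iff hM).2 (hc.continuousOn.integrableOn_compact
      (isCompact_cornerSimplex _))
  have hmp := (volume_preserving_piFinSuccAbove (fun _ : Fin (m + 1) => ℝ) 0).symm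
  have hsymm (p : ℝ × (Fin m → ℝ)) :
      (MeasurableEquiv.piFinSuccAbove (fun _ : Fin (m + 1) => ℝ) 0).symm p =
        (Fin.cons p.1 p.2 : Fin (m + 1) → ℝ) := by
    simp [MeasurableEquiv.piFinSuccAbove_symm_apply]
    rfl
  rw [← integral_indicator hM, ← hmp.integral_comp']
  have hint2 := (hmp.integrable_comp_emb (MeasurableEquiv.measurableEmbedding _)).2 hint
  simp only [Function.comp_def, hsymm] at hint2
  simp only [hsymm]
  rw [Measure.volume_eq_prod] at hint2 ⊢
  rw [integral_prod _ hint2]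
  -- The slice at height s is the corner simplex of dimension m scaled by 1 - s; undoing the scaling
  -- gives the Jacobian (1-s)^m. The null set s = 1 is left out because the scaling degenerates
  -- there, and the union on the right is the interval [0, 1).
  have hinner : ∀ s : ℝ, s ≠ 1 →
      ∫ y : Fin m → ℝ, (cornerSimplex (m + 1)).indicator h (Fin.cons s y) =
      (Ioo (0 : ℝ) 1 ∪ {0}).indicator (fun s => ∫ y in cornerSimplex m,
        (1 - s) ^ m * h (Fin.cons s ((1 - s) • y))) s := by
    intro s hs1
    by_cases hs : s ∈ Ioo (0 : ℝ) 1 ∪ {0}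
    · have h0 : 0 ≤ s := by
        rcases hs with hs | hs
        · exact hs.1.le
        · exact hs.ge
      have h1 : s < 1 := by
        rcases hs with hs | hs
        · exact hs.2
        · rw [hs]; norm_num
      have hpos : 0 < 1 - s := sub_pos.2 h1
      rw [indicator_of_mem hs]
      have : (fun y : Fin m → ℝ => (cornerSimplex (m + 1)).indicator h (Fin.cons s y)) =
          ((1 - s) • cornerSimplex m).indicator fun y => h (Fin.cons s y) := by
        funext y
        by_cases hy : y ∈ (1 - s) • cornerSimplex m
        · rw [indicator_of_mem hy,
            indicator_of_mem ((cons_mem_cornerSimplex_iff_mem_smul h0 h1).2 hy)]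
        · rw [indicator_of_notMem hy,
            indicator_of_notMem (fun h => hy ((cons_mem_cornerSimplex_iff_mem_smul h0 h1).1 h))]
      rw [this, integral_indicator ((isCompact_cornerSimplex m).smul _).measurableSet,
        integral_const_mul, Measure.setIntegral_comp_smul_of_pos volume
          (fun y => h (Fin.cons s y)) _ hpos]
      have hne : (1 - s) ^ m ≠ 0 := by positivity
      simp only [Module.finrank_fin_fun, smul_eq_mul]
      rw [mul_inv_cancel_left₀ hne]
    · rw [indicator_of_notMem hs]
      refine integral_eq_zero_of_ae (Filter.Eventually.of_forall fun y => ?_)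
      refine indicator_of_notMem (fun hy => hs ?_) h
      obtain ⟨a, b, c⟩ := cons_mem_cornerSimplex.1 hy
      have : 0 ≤ ∑ i, y i := Finset.sum_nonneg fun i _ => b i
      rcases a.eq_or_lt with a | a
      · exact Or.inr a.symm
      · exact Or.inl ⟨a, lt_of_le_of_ne (by linarith) hs1⟩
  have hae : ∀ᵐ s : ℝ, s ≠ 1 := by
    simp [ae_iff]
  rw [integral_congr_ae (hae.mono hinner), integral_indicator
    (measurableSet_Ioo.union (measurableSet_singleton 0))]
  have hsets : (Ioo (0 : ℝ) 1 ∪ {0} : Set ℝ) =ᵐ[volume] Icc 0 1 := by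
    rw [union_comm, singleton_union, Ioo_insert_left (by norm_num)]
    exact Ico_ae_eq_Icc
  rw [setIntegral_congr_set hsets, integral_integral_swap]
  · refine integral_eq_zero_of_ae ?_
    filter_upwards [ae_restrict_mem (isCompact_cornerSimplex m).measurableSet] with y hy
    rw [integral_Icc_eq_integral_Ioc, ← intervalIntegral.integral_of_le zero_le_one]
    exact hz y hy
  · rw [Measure.prod_restrict]
    refine Continuous.continuousOn ?_ |>.integrableOn_compact
      (isCompact_Icc.prod (isCompact_cornerSimplex m))
    refine (((continuous_const.sub continuous_fst).pow m).mul (hc.comp (hcons.comp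
      (continuous_fst.prodMk ((continuous_const.sub continuous_fst).smul continuous_snd)))))

/-- The affine parametrization of a simplex by the corner simplex. -/
def simplexMap {d n : ℕ} (y : Fin (n + 1) → Euc d) (t : Fin n → ℝ) : Euc d :=
  y 0 + ∑ i, t i • (y i.succ - y 0)

theorem continuous_simplexMap {d n : ℕ} (y : Fin (n + 1) → Euc d) :
    Continuous (simplexMap y) := by
  unfold simplexMap
  fun_prop

theorem image_simplexMap {d n : ℕ} (y : Fin (n + 1) → Euc d) :
    simplexMap y '' cornerSimplex n = convexHull ℝ (range y) := by
  apply Subset.antisymm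
  · rintro _ ⟨t, ht, rfl⟩
    have : simplexMap y t = ∑ j, (Fin.cons (1 - ∑ i, t i) t : Fin (n + 1) → ℝ) j • y j := by
      rw [Fin.sum_univ_succ]
      simp only [Fin.cons_zero, Fin.cons_succ, simplexMap, smul_sub, Finset.sum_sub_distrib,
        sub_smul, one_smul, Finset.sum_smul]
      abel
    rw [this]
    refine (convex_convexHull ℝ _).sum_mem (fun j _ => ?_) ?_
      (fun j _ => subset_convexHull ℝ _ (mem_range_self j))
    · refine Fin.cases ?_ (fun i => ?_) j
      · simpa using ht.2
      · simpa using ht.1 i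
    · simp [Fin.sum_univ_succ]
  · refine convexHull_min ?_ ?_
    · rintro _ ⟨j, rfl⟩
      refine Fin.cases ⟨0, by simp [cornerSimplex], by simp [simplexMap]⟩ (fun i => ?_) j
      refine ⟨Pi.single i 1, ⟨fun i' => ?_, ?_⟩, ?_⟩
      · by_cases h : i' = i
        · subst h; simp
        · simp [h]
      · simp
      · simp only [simplexMap]
        rw [Finset.sum_eq_single_of_mem i (Finset.mem_univ _) (fun j _ hj => by simp [hj])]
        simp
    · rintro _ ⟨s, hs, rfl⟩ _ ⟨t, ht, rfl⟩ a b ha hb hab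
      refine ⟨a • s + b • t, convex_cornerSimplex n hs ht ha hb hab, ?_⟩
      simp only [simplexMap, Pi.add_apply, Pi.smul_apply, smul_eq_mul, add_smul, mul_smul,
        Finset.sum_add_distrib, smul_add, Finset.smul_sum]
      have : y 0 = a • y 0 + b • y 0 := by rw [← add_smul, hab, one_smul]
      nth_rw 1 [this]
      abel

/-- The `n`-dimensional Hausdorff measure on a simplex is a multiple of the image of the Lebesgue
measure under the affine parametrization. -/
theorem exists_restrict_euclideanHausdorffMeasure_eq {d n : ℕ} (y : Fin (n + 1) → Euc d) :
    ∃ c : ℝ≥0∞, c ≠ ∞ ∧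
      (Measure.euclideanHausdorffMeasure n).restrict (convexHull ℝ (range y)) =
        c • (volume.restrict (cornerSimplex n)).map (simplexMap y) := by
  -- The linear part of the parametrization scales n-dimensional volume by the constant factor
  -- `L.normDet`; later only the finiteness of this factor matters.
  let L : EuclideanSpace ℝ (Fin n) →ₗ[ℝ] Euc d :=
    { toFun := fun t => ∑ i, t i • (y i.succ - y 0)
      map_add' := fun s t => by simp [add_smul, Finset.sum_add_distrib]
      map_smul' := fun c t => by simp [mul_smul, Finset.smul_sum] }
  refine ⟨ENNReal.ofReal L.normDet, ENNReal.ofReal_ne_top, ?_⟩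
  have hm := (continuous_simplexMap y).measurable
  have hcl : MeasurableSet (convexHull ℝ (range y)) :=
    ((finite_range y).isCompact_convexHull ℝ).measurableSet
  ext B hB
  rw [Measure.restrict_apply hB, Measure.smul_apply, Measure.map_apply hm hB,
    Measure.restrict_apply (hm hB), ← image_simplexMap, inter_comm B, ← image_inter_preimage]
  set A := cornerSimplex n ∩ simplexMap y ⁻¹' B
  have hA : MeasurableSet A := (isCompact_cornerSimplex n).measurableSet.inter (hm hB)
  have e : simplexMap y '' A =
      (fun x => y 0 + x) '' (L '' (WithLp.ofLp ⁻¹' A)) := by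
    ext x
    constructor
    · rintro ⟨t, ht, rfl⟩
      exact ⟨_, ⟨WithLp.toLp 2 t, ht, rfl⟩, rfl⟩
    · rintro ⟨_, ⟨t, ht, rfl⟩, rfl⟩
      exact ⟨_, ht, rfl⟩
  have h1 := L.euclideanHausdorffMeasure_image_eq_normDet_mul_volume (WithLp.ofLp ⁻¹' A)
  rw [finrank_euclideanSpace_fin] at h1
  have h2 := (isometry_add_left (y 0)).euclideanHausdorffMeasure_image (d := n)
    (L '' (WithLp.ofLp ⁻¹' A))
  rw [e, h2, h1,
    (PiLp.volume_preserving_ofLp (Fin n)).measure_preimage hA.nullMeasurableSet, inter_comm]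
  rfl

theorem integrableOn_convexHull_euclideanHausdorffMeasure {d n : ℕ} (y : Fin (n + 1) → Euc d)
    {g : Euc d → ℝ} (hg : Continuous g) :
    IntegrableOn g (convexHull ℝ (range y)) (Measure.euclideanHausdorffMeasure n) := by
  obtain ⟨c, hc, h⟩ := exists_restrict_euclideanHausdorffMeasure_eq y
  rw [IntegrableOn, h]
  refine Integrable.smul_measure ?_ hc
  rw [integrable_map_measure hg.aestronglyMeasurable
    (continuous_simplexMap y).measurable.aemeasurable]
  exact (hg.comp (continuous_simplexMap y)).continuousOn.integrableOn_compact
    (isCompact_cornerSimplex n)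

/-- The restriction of a polynomial to a line. -/
theorem exists_polyFun_line {d : ℕ} (q : MvPolynomial (Fin d) ℝ) (A B : Euc d) :
    ∃ Q : Polynomial ℝ, Q.natDegree ≤ q.totalDegree ∧ ∀ s : ℝ, polyFun q (A + s • B) = Q.eval s := by
  refine ⟨MvPolynomial.aeval (fun i => Polynomial.C (A i) + Polynomial.C (B i) * Polynomial.X) q,
    ?_, fun s => ?_⟩
  · have := MvPolynomial.aeval_natDegree_le (n := 1) q le_rfl
      (fun i => Polynomial.C (A i) + Polynomial.C (B i) * Polynomial.X) (fun i => by
        rw [add_comm]; exact Polynomial.natDegree_linear_le)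
    simpa using this
  · rw [polyFun, ← Polynomial.coe_evalRingHom, MvPolynomial.aeval_def, MvPolynomial.hom_eval₂]
    rw [← MvPolynomial.eval₂_id]
    congr 1
    · ext; simp
    · ext i; simp; ring

theorem continuous_polyFun {d : ℕ} (q : MvPolynomial (Fin d) ℝ) : Continuous (polyFun q) := by
  unfold polyFun
  exact (MvPolynomial.continuous_eval q).comp (by fun_prop)

/-- The Jacobi polynomials in a barycentric coordinate are orthogonal on a simplex of dimension
`m + 1` to the polynomials of lower degree. -/
theorem setIntegral_convexHull_jacobiPoly_mul_eq_zero {d m k : ℕ} (y : Fin (m + 2) → Euc d)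
    (l : Euc d →ᵃ[ℝ] ℝ) (h1 : l (y 1) = 1) (h0 : ∀ j, j ≠ 1 → l (y j) = 0)
    (q : MvPolynomial (Fin d) ℝ) (hq : q.totalDegree < k) :
    ∫ x in convexHull ℝ (range y), (jacobiPoly 0 m k).eval (1 - 2 * l x) * polyFun q x
      ∂(Measure.euclideanHausdorffMeasure (m + 1)) = 0 := by
  obtain ⟨c, hc, h⟩ := exists_restrict_euclideanHausdorffMeasure_eq y
  have hl : Continuous l := l.continuous_of_finiteDimensional
  have hcont : Continuous fun x => (jacobiPoly 0 m k).eval (1 - 2 * l x) * polyFun q x :=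
    ((Polynomial.continuous _).comp (by fun_prop)).mul (continuous_polyFun q)
  rw [h, integral_smul_measure, integral_map (continuous_simplexMap y).measurable.aemeasurable
    hcont.aestronglyMeasurable, setIntegral_cornerSimplex_eq_zero, smul_zero]
  · exact hcont.comp (continuous_simplexMap y)
  intro w _
  have hls (t : Fin (m + 1) → ℝ) : l (simplexMap y t) = t 0 := by
    have e1 (i : Fin (m + 1)) : l.linear (y i.succ - y 0) = if i = 0 then 1 else 0 := by
      have := l.linearMap_vsub (y i.succ) (y 0)
      rw [vsub_eq_sub, vsub_eq_sub, h0 0 (by simp)] at this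
      rw [this]
      split_ifs with hi
      · subst hi
        simpa using h1
      · rw [h0 _ (fun h => hi (Fin.succ_injective _ h)), sub_zero]
    have e2 : simplexMap y t = (∑ i, t i • (y i.succ - y 0)) +ᵥ y 0 := by
      rw [simplexMap, vadd_eq_add, add_comm]
    rw [e2, l.map_vadd, map_sum, h0 0 (by simp)]
    simp [e1]
  -- For fixed w, the point with parameters s and (1-s)w runs on a straight line that reaches the
  -- vertex `y 1` at s = 1. There q is a polynomial in s of degree less than k, and the cone weight
  -- (1-s)^m is the weight of the one-dimensional orthogonality.
  obtain ⟨Q, hQ, hQe⟩ := exists_polyFun_line q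
    (y 0 + ∑ i : Fin m, w i • (y i.succ.succ - y 0))
    ((y 1 - y 0) - ∑ i : Fin m, w i • (y i.succ.succ - y 0))
  have hline (s : ℝ) : simplexMap y (Fin.cons s ((1 - s) • w)) =
      (y 0 + ∑ i : Fin m, w i • (y i.succ.succ - y 0)) +
        s • ((y 1 - y 0) - ∑ i : Fin m, w i • (y i.succ.succ - y 0)) := by
    simp only [simplexMap]
    rw [Fin.sum_univ_succ]
    simp only [Fin.cons_zero, Fin.cons_succ, Pi.smul_apply, smul_eq_mul, mul_smul,
      ← Finset.smul_sum, Fin.succ_zero_eq_one]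
    module
  refine Eq.trans ?_ (integral_jacobiPoly_mul_eq_zero m Q (hQ.trans_lt hq))
  refine intervalIntegral.integral_congr fun s _ => ?_
  simp only [hls]
  simp only [hline, hQe, Fin.cons_zero]
  ring

/-- The distinguished vertex gets index 1 because `simplexMap` takes `y 0` as origin, so that the
parameter `t 0` is the barycentric coordinate of `y 1`. -/
theorem exists_enumeration_of_mem {α : Type*} {m : ℕ} {F : Finset α} (hF : F.card = m + 2) {z : α}
    (hz : z ∈ F) : ∃ y : Fin (m + 2) → α, Function.Injective y ∧ range y = (F : Set α) ∧ y 1 = z := by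
  let e : Fin (m + 2) ≃ F := ((finCongr hF.symm).trans F.equivFin.symm)
  let e' : Fin (m + 2) ≃ F := (Equiv.swap 1 (e.symm ⟨z, hz⟩)).trans e
  refine ⟨fun i => (e' i : α), Subtype.val_injective.comp e'.injective, ?_, by simp [e']⟩
  rw [show (fun i => (e' i : α)) = Subtype.val ∘ e' from rfl, range_comp, e'.range_eq_univ]
  simp

theorem integrableOn_facet {d : ℕ} (hd : 2 ≤ d) {F : Finset (Euc d)} (hF : F.card = d)
    {g : Euc d → ℝ} (hg : Continuous g) :
    IntegrableOn g (convexHull ℝ (F : Set (Euc d))) (Measure.euclideanHausdorffMeasure (d - 1)) := by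
  obtain ⟨m, rfl⟩ := Nat.exists_eq_add_of_le' hd
  obtain ⟨z, hz⟩ := Finset.card_pos.1 (by omega : 0 < F.card)
  obtain ⟨y, -, hy, -⟩ := exists_enumeration_of_mem hF hz
  rw [← hy]
  exact integrableOn_convexHull_euclideanHausdorffMeasure y hg

/-! ### Orthogonality on facets and barycentric coordinates of cells. -/

namespace SimplicialMesh

variable {d : ℕ} {Ω : Set (Euc d)} (T : SimplicialMesh Ω)

theorem FacetOrth.congr {k : ℕ} {F : Finset (Euc d)} {g h : Euc d → ℝ}
    (hg : FacetOrth k F g) (hgh : EqOn g h (convexHull ℝ (F : Set (Euc d)))) :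
    FacetOrth k F h := by
  intro q hq
  rw [← hg q hq]
  refine setIntegral_congr_fun (F.finite_toSet.isCompact_convexHull ℝ).measurableSet
    fun x hx => ?_
  simp only [hgh hx]

theorem FacetOrth.const_smul {k : ℕ} {F : Finset (Euc d)} {g : Euc d → ℝ}
    (hg : FacetOrth k F g) (c : ℝ) : FacetOrth k F (c • g) := by
  intro q hq
  simp only [Pi.smul_apply, smul_eq_mul, mul_assoc]
  rw [integral_const_mul, hg q hq, mul_zero]

theorem FacetOrth.sum {k : ℕ} {F : Finset (Euc d)} (hd : 2 ≤ d) (hF : F.card = d) {ι : Type*}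
    (s : Finset ι) (g : ι → Euc d → ℝ) (hgc : ∀ i ∈ s, Continuous (g i))
    (hg : ∀ i ∈ s, FacetOrth k F (g i)) : FacetOrth k F (fun x => ∑ i ∈ s, g i x) := by
  intro q hq
  simp only [Finset.sum_mul]
  rw [integral_finsetSum _ fun i hi =>
    integrableOn_facet hd hF ((hgc i hi).fun_mul (continuous_polyFun q))]
  exact Finset.sum_eq_zero fun i hi => hg i hi q hq

theorem bary_apply_vertex [DecidableEq (Euc d)] (K : T.cells) (z : K.1) {y : Euc d} (hy : y ∈ K.1) :
    T.bary K z y = if y = z then 1 else 0 := by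
  have := (T.affineBasis K).coord_apply z ⟨y, hy⟩
  rw [show (T.affineBasis K) ⟨y, hy⟩ = y from rfl] at this
  rw [bary, this]
  simp [Subtype.ext_iff, eq_comm]

theorem facetOrth_jacobiBary (hd : 2 ≤ d) (k : ℕ) (K : T.cells) {F : Finset (Euc d)}
    (hF : F.card = d) (hFK : F ⊆ K.1) (z : K.1) (hz : (z : Euc d) ∈ F) :
    FacetOrth k F (T.jacobiBary k K z) := by
  classical
  obtain ⟨m, rfl⟩ := Nat.exists_eq_add_of_le' hd
  obtain ⟨y, hinj, hy, hy1⟩ := exists_enumeration_of_mem hF hz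
  have hyF (j) : y j ∈ F := by
    have : y j ∈ (F : Set _) := hy ▸ mem_range_self j
    exact this
  intro q hq
  have := setIntegral_convexHull_jacobiPoly_mul_eq_zero y ((T.affineBasis K).coord z)
    (by
      have := T.bary_apply_vertex K z (hFK (hyF 1))
      rwa [if_pos hy1] at this)
    (fun j hj => by
      have := T.bary_apply_vertex K z (hFK (hyF j))
      rwa [if_neg (fun h => hj (hinj (h.trans hy1.symm)))] at this) q hq
  rw [hy] at this
  rw [← this]
  simp [jacobiBary, bary]

open Classical in
/-- The barycentric coordinate of the cell `K` for the point `z`; it is zero if `z` is not a vertex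
of `K`. -/
noncomputable def baryAff (K : T.cells) (z : Euc d) : Euc d →ᵃ[ℝ] ℝ :=
  if h : z ∈ K.1 then (T.affineBasis K).coord ⟨z, h⟩ else 0

theorem baryAff_of_mem (K : T.cells) (z : K.1) (x : Euc d) : T.baryAff K z x = T.bary K z x := by
  rw [baryAff, dif_pos z.2, bary]

theorem baryAff_of_notMem (K : T.cells) {z : Euc d} (hz : z ∉ K.1) (x : Euc d) :
    T.baryAff K z x = 0 := by
  rw [baryAff, dif_neg hz]
  rfl

theorem continuous_baryAff (K : T.cells) (z : Euc d) : Continuous (T.baryAff K z) :=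
  (T.baryAff K z).continuous_of_finiteDimensional

open Classical in
theorem baryAff_apply_vertex (K : T.cells) (z : Euc d) {y : Euc d} (hy : y ∈ K.1) :
    T.baryAff K z y = if y = z then 1 else 0 := by
  by_cases hz : z ∈ K.1
  · exact (T.baryAff_of_mem K ⟨z, hz⟩ y).trans (T.bary_apply_vertex K ⟨z, hz⟩ hy)
  · rw [T.baryAff_of_notMem K hz, if_neg]
    rintro rfl
    exact hz hy

theorem baryAff_combo (K : T.cells) (z x y : Euc d) {a b : ℝ} (hab : a + b = 1) :
    T.baryAff K z (a • x + b • y) = a * T.baryAff K z x + b * T.baryAff K z y := by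
  have := Convex.combo_affine_apply (f := T.baryAff K z) (x := x) (y := y) hab
  simpa using this

theorem sum_baryAff (K : T.cells) (x : Euc d) : ∑ z ∈ K.1, T.baryAff K z x = 1 := by
  rw [← Finset.sum_coe_sort]
  simp only [baryAff_of_mem]
  exact (T.affineBasis K).sum_coord_apply_eq_one x

theorem sum_baryAff_smul (K : T.cells) (x : Euc d) : ∑ z ∈ K.1, T.baryAff K z x • z = x := by
  rw [← Finset.sum_coe_sort]
  simp only [baryAff_of_mem]
  exact (T.affineBasis K).linear_combination_coord_eq_self x

theorem range_affineBasis (K : T.cells) : range (T.affineBasis K) = (K.1 : Set (Euc d)) := by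
  change range (Subtype.val : K.1 → Euc d) = _
  simp

theorem mem_convexHull_iff (K : T.cells) (x : Euc d) :
    x ∈ convexHull ℝ (K.1 : Set (Euc d)) ↔ ∀ z, 0 ≤ T.baryAff K z x := by
  rw [← range_affineBasis, AffineBasis.convexHull_eq_nonneg_coord]
  constructor
  · intro h z
    by_cases hz : z ∈ K.1
    · have := h ⟨z, hz⟩
      rwa [baryAff, dif_pos hz]
    · rw [T.baryAff_of_notMem K hz]
  · intro h z
    rw [← bary, ← baryAff_of_mem]
    exact h z

theorem mem_interior_convexHull_iff (K : T.cells) (x : Euc d) :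
    x ∈ interior (convexHull ℝ (K.1 : Set (Euc d))) ↔ ∀ z ∈ K.1, 0 < T.baryAff K z x := by
  rw [← range_affineBasis, AffineBasis.interior_convexHull]
  constructor
  · intro h z hz
    rw [baryAff, dif_pos hz]
    exact h ⟨z, hz⟩
  · intro h z
    rw [← bary, ← baryAff_of_mem]
    exact h z z.2

/-! ### Cells, supports of points, and the position of faces relative to the boundary. -/

theorem isClosed_cell (K : T.cells) : IsClosed (convexHull ℝ (K.1 : Set (Euc d))) :=
  (K.1.finite_toSet.isCompact_convexHull ℝ).isClosed

theorem cell_subset_closure (K : T.cells) :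
    convexHull ℝ (K.1 : Set (Euc d)) ⊆ closure Ω := by
  rw [← T.cover]
  exact subset_biUnion_of_mem (u := fun K : Finset (Euc d) => convexHull ℝ (K : Set (Euc d))) K.2

theorem exists_cell_of_mem_closure {x : Euc d} (hx : x ∈ closure Ω) :
    ∃ K : T.cells, x ∈ convexHull ℝ (K.1 : Set (Euc d)) := by
  rw [← T.cover] at hx
  obtain ⟨K, hK, hx⟩ := mem_iUnion₂.1 hx
  exact ⟨⟨K, hK⟩, hx⟩

/-- On the intersection of two cells the barycentric coordinates agree. -/
theorem baryAff_eq {K K' : T.cells} {x : Euc d} (hx : x ∈ convexHull ℝ (K.1 : Set (Euc d)))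
    (hx' : x ∈ convexHull ℝ (K'.1 : Set (Euc d))) (z : Euc d) :
    T.baryAff K z x = T.baryAff K' z x := by
  classical
  have h : x ∈ convexHull ℝ ((K.1 : Set (Euc d)) ∩ K'.1) :=
    T.conforming K.1 K.2 K'.1 K'.2 ▸ ⟨hx, hx'⟩
  refine convexHull_min (t := {x | T.baryAff K z x = T.baryAff K' z x}) ?_ ?_ h
  · rintro y ⟨hy, hy'⟩
    change _ = _
    rw [T.baryAff_apply_vertex K z hy, T.baryAff_apply_vertex K' z hy']
  · intro a ha b hb s t _ _ hst
    change _ = _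
    rw [T.baryAff_combo K z a b hst, T.baryAff_combo K' z a b hst, ha, hb]

theorem mem_of_baryAff_ne_zero {K : T.cells} {x z : Euc d} (h : T.baryAff K z x ≠ 0) :
    z ∈ K.1 := by
  by_contra hz
  exact h (T.baryAff_of_notMem K hz x)

theorem mem_convexHull_of_support (K : T.cells) {A : Set (Euc d)} {x : Euc d}
    (hx : x ∈ convexHull ℝ (K.1 : Set (Euc d))) (hA : ∀ z, 0 < T.baryAff K z x → z ∈ A) :
    x ∈ convexHull ℝ A := by
  classical
  have h0 := (T.mem_convexHull_iff K x).1 hx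
  have h1 := T.sum_baryAff K x
  have h2 := T.sum_baryAff_smul K x
  rw [← Finset.sum_filter_of_ne (p := fun z => 0 < T.baryAff K z x)
    (fun z _ hz => lt_of_le_of_ne (h0 z) (Ne.symm hz))] at h1
  rw [← Finset.sum_filter_of_ne (p := fun z => 0 < T.baryAff K z x)
    (fun z _ hz => lt_of_le_of_ne (h0 z) (fun h => hz (by rw [← h, zero_smul])))] at h2
  rw [← h2]
  exact (convex_convexHull ℝ A).sum_mem (fun z _ => h0 z) h1
    (fun z hz => subset_convexHull ℝ A (hA z (Finset.mem_filter.1 hz).2))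

theorem cell_eq_of_subset {K K' : T.cells} (h : K.1 ⊆ K'.1) : K = K' :=
  Subtype.ext (Finset.eq_of_subset_of_card_le h
    (by rw [T.card_eq _ K.2, T.card_eq _ K'.2]))

/-- At an interior point all coordinates of K are positive. They coincide with those of K' on the
intersection, so every vertex of K is one of K'. -/
theorem eq_of_mem_interior {K K' : T.cells} {x : Euc d}
    (hx : x ∈ interior (convexHull ℝ (K.1 : Set (Euc d))))
    (hx' : x ∈ convexHull ℝ (K'.1 : Set (Euc d))) : K = K' := by
  refine T.cell_eq_of_subset fun z hz => ?_
  have h := (T.mem_interior_convexHull_iff K x).1 hx z hz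
  rw [T.baryAff_eq (interior_subset hx) hx' z] at h
  exact T.mem_of_baryAff_ne_zero h.ne'

theorem interior_nonempty (K : T.cells) :
    (interior (convexHull ℝ (K.1 : Set (Euc d)))).Nonempty := by
  rw [← range_affineBasis]
  exact ⟨_, (T.affineBasis K).centroid_mem_interior_convexHull⟩

theorem closure_interior_cell (K : T.cells) :
    closure (interior (convexHull ℝ (K.1 : Set (Euc d)))) = convexHull ℝ (K.1 : Set (Euc d)) := by
  rw [(convex_convexHull ℝ _).closure_interior_eq_closure_of_nonempty_interior
    (T.interior_nonempty K), (T.isClosed_cell K).closure_eq]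

theorem interior_cell_subset (hreg : interior (closure Ω) = Ω) (K : T.cells) :
    interior (convexHull ℝ (K.1 : Set (Euc d))) ⊆ Ω := by
  exact (interior_mono (T.cell_subset_closure K)).trans hreg.subset

/-- Near a point there are only the cells that contain the point. -/
theorem eventually_mem_cell_imp (x : Euc d) :
    ∀ᶠ y in nhds x, ∀ K : T.cells, y ∈ convexHull ℝ (K.1 : Set (Euc d)) →
      x ∈ convexHull ℝ (K.1 : Set (Euc d)) := by
  rw [Filter.eventually_all]
  intro K
  by_cases hx : x ∈ convexHull ℝ (K.1 : Set (Euc d))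
  · exact Filter.Eventually.of_forall fun _ _ => hx
  · filter_upwards [(T.isClosed_cell K).isOpen_compl.mem_nhds hx] with y hy h
    exact absurd h hy

/-- Being in the same open face, x and y allow the segment from x to be prolonged beyond y to a
point w = y + t(y-x) of that face. The homothety with centre w that sends y to x maps each y' near y
to a point x' near x. A cell containing x' also contains x, hence the face and w, hence y' by
convexity. So a neighbourhood of y lies in the closure of Ω, and Ω is the interior of its closure.
-/
theorem mem_of_support_eq (hreg : interior (closure Ω) = Ω) {K : T.cells} {x y : Euc d}
    (hxΩ : x ∈ Ω) (hx : x ∈ convexHull ℝ (K.1 : Set (Euc d)))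
    (hy : y ∈ convexHull ℝ (K.1 : Set (Euc d)))
    (hxy : ∀ z, 0 < T.baryAff K z x ↔ 0 < T.baryAff K z y) : y ∈ Ω := by
  have hopen : IsOpen Ω := hreg ▸ isOpen_interior
  have hx0 := (T.mem_convexHull_iff K x).1 hx
  have hy0 := (T.mem_convexHull_iff K y).1 hy
  have hcomb (t : ℝ) (z : Euc d) : T.baryAff K z ((1 + t) • y + (-t) • x) =
      (1 + t) * T.baryAff K z y + (-t) * T.baryAff K z x :=
    T.baryAff_combo K z y x (by ring)
  obtain ⟨t, ht0, ht⟩ : ∃ t : ℝ, 0 < t ∧ ∀ z ∈ K.1,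
      0 ≤ (1 + t) * T.baryAff K z y + (-t) * T.baryAff K z x := by
    have : ∀ᶠ t in nhdsWithin (0 : ℝ) (Ioi 0), ∀ z ∈ K.1,
        0 ≤ (1 + t) * T.baryAff K z y + (-t) * T.baryAff K z x := by
      rw [Filter.eventually_all_finset]
      intro z _
      rcases (hy0 z).eq_or_lt with h | h
      · have h' : T.baryAff K z x = 0 :=
          le_antisymm (not_lt.1 fun h'' => ((hxy z).1 h'').ne h) (hx0 z)
        refine Filter.Eventually.of_forall fun t => ?_
        rw [← h, h']
        simp
      · have hc : Continuous fun t : ℝ => (1 + t) * T.baryAff K z y + (-t) * T.baryAff K z x := by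
          fun_prop
        have : ∀ᶠ t in nhds (0 : ℝ), 0 < (1 + t) * T.baryAff K z y + (-t) * T.baryAff K z x :=
          hc.continuousAt.eventually (lt_mem_nhds (by simpa using h))
        filter_upwards [this.filter_mono nhdsWithin_le_nhds] with t ht using ht.le
    obtain ⟨t, h1, h2⟩ := (this.and self_mem_nhdsWithin).exists
    exact ⟨t, h2, h1⟩
  set w : Euc d := (1 + t) • y + (-t) • x with hw
  have hwK : w ∈ convexHull ℝ (K.1 : Set (Euc d)) := by
    rw [T.mem_convexHull_iff]
    intro z
    by_cases hz : z ∈ K.1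
    · rw [hw, hcomb]
      exact ht z hz
    · rw [T.baryAff_of_notMem K hz]
  have hwx (z : Euc d) (hz : 0 < T.baryAff K z w) : 0 < T.baryAff K z x := by
    rw [hxy]
    by_contra h
    have h' : T.baryAff K z y = 0 := le_antisymm (not_lt.1 h) (hy0 z)
    rw [hw, hcomb, h'] at hz
    have := mul_nonneg ht0.le (hx0 z)
    linarith
  rw [← hreg, mem_interior_iff_mem_nhds]
  -- The map sending y' to x' is the homothety with centre w and ratio (1+t)/t.
  have hlim : Filter.Tendsto (fun y' : Euc d => x + ((1 + t) / t) • (y' - y)) (nhds y) (nhds x) := by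
    have : Continuous fun y' : Euc d => x + ((1 + t) / t) • (y' - y) := by fun_prop
    simpa using this.tendsto y
  filter_upwards [hlim.eventually (T.eventually_mem_cell_imp x),
    hlim.eventually (hopen.mem_nhds hxΩ)] with y' h1 h2
  obtain ⟨K', hK'⟩ := T.exists_cell_of_mem_closure (subset_closure h2)
  have hxK' := h1 K' hK'
  have hwK' : w ∈ convexHull ℝ (K'.1 : Set (Euc d)) :=
    T.mem_convexHull_of_support K hwK fun z hz => by
      have := hwx z hz
      rw [T.baryAff_eq hx hxK' z] at this
      exact T.mem_of_baryAff_ne_zero this.ne'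
  refine T.cell_subset_closure K' ?_
  have h1t : 0 < 1 + t := by linarith
  have : y' = (1 / (1 + t)) • w + (t / (1 + t)) • (x + ((1 + t) / t) • (y' - y)) := by
    rw [hw]
    match_scalars <;> field_simp <;> ring
  rw [this]
  exact convex_convexHull ℝ _ hwK' hK' (by positivity) (by positivity) (by field_simp)

/-- If a point of a cell lies in `Ω`, then so do all points of the cell with larger support. -/
theorem mem_of_support_le (hreg : interior (closure Ω) = Ω) {K : T.cells} {x y : Euc d}
    (hxΩ : x ∈ Ω) (hx : x ∈ convexHull ℝ (K.1 : Set (Euc d)))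
    (hy : y ∈ convexHull ℝ (K.1 : Set (Euc d)))
    (hxy : ∀ z, 0 < T.baryAff K z x → 0 < T.baryAff K z y) : y ∈ Ω := by
  have hopen : IsOpen Ω := hreg ▸ isOpen_interior
  have hx0 := (T.mem_convexHull_iff K x).1 hx
  have hy0 := (T.mem_convexHull_iff K y).1 hy
  have hlim : Filter.Tendsto (fun s : ℝ => (1 - s) • x + s • y) (nhdsWithin 0 (Ioi 0))
      (nhds x) := by
    have : Continuous fun s : ℝ => (1 - s) • x + s • y := by fun_prop
    have h := this.tendsto 0
    simp only [sub_zero, one_smul, zero_smul, add_zero] at h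
    exact h.mono_left nhdsWithin_le_nhds
  -- A small move from x towards y stays in the open set Ω and gives the point exactly the support
  -- of y.
  obtain ⟨s, h1, h2, h3⟩ := ((hlim.eventually (hopen.mem_nhds hxΩ)).and
    ((Ioo_mem_nhdsGT (zero_lt_one' ℝ)))).exists
  refine T.mem_of_support_eq hreg h1
    (convex_convexHull ℝ _ hx hy (sub_pos.2 h3).le h2.le (by ring)) hy fun z => ?_
  rw [T.baryAff_combo K z x y (by ring)]
  have hs : 0 < 1 - s := sub_pos.2 h3
  constructor
  · intro h
    by_contra hc
    have h0 : T.baryAff K z y = 0 := le_antisymm (not_lt.1 hc) (hy0 z)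
    have h0' : T.baryAff K z x = 0 := le_antisymm (not_lt.1 fun h' => hc (hxy z h')) (hx0 z)
    rw [h0, h0'] at h
    simp at h
  · intro h
    have := mul_pos h2 h
    have := mul_nonneg hs.le (hx0 z)
    linarith

theorem mem_of_mem_closure_of_notMem_frontier (hreg : interior (closure Ω) = Ω) {x : Euc d}
    (hx : x ∈ closure Ω) (hx' : x ∉ frontier Ω) : x ∈ Ω := by
  have hopen : IsOpen Ω := hreg ▸ isOpen_interior
  by_contra h
  exact hx' (hopen.frontier_eq ▸ ⟨hx, h⟩)

theorem notMem_of_mem_frontier (hreg : interior (closure Ω) = Ω) {x : Euc d}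
    (hx : x ∈ frontier Ω) : x ∉ Ω := by
  have hopen : IsOpen Ω := hreg ▸ isOpen_interior
  rw [hopen.frontier_eq] at hx
  exact hx.2

theorem vertex_mem_cell {K : T.cells} {z : Euc d} (hz : z ∈ K.1) :
    z ∈ convexHull ℝ (K.1 : Set (Euc d)) := subset_convexHull ℝ _ hz

/-- If the vertex z were in Ω, then y, whose support contains that of z, would be in Ω as well. -/
theorem vertex_mem_frontier (hreg : interior (closure Ω) = Ω) {K : T.cells} {y z : Euc d}
    (hy : y ∈ convexHull ℝ (K.1 : Set (Euc d))) (hyf : y ∈ frontier Ω)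
    (hz : 0 < T.baryAff K z y) : z ∈ frontier Ω := by
  classical
  have hzK := T.mem_of_baryAff_ne_zero hz.ne'
  by_contra h
  have hzΩ := mem_of_mem_closure_of_notMem_frontier hreg
    (T.cell_subset_closure K (T.vertex_mem_cell hzK)) h
  refine notMem_of_mem_frontier hreg hyf
    (T.mem_of_support_le hreg hzΩ (T.vertex_mem_cell hzK) hy fun z' hz' => ?_)
  rw [T.baryAff_apply_vertex K z' hzK] at hz'
  split_ifs at hz' with h
  · rwa [← h]
  · exact absurd hz' (lt_irrefl 0)

theorem exists_vertex_baryAff_pos (K : T.cells) {x : Euc d}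
    (hx : x ∈ convexHull ℝ (K.1 : Set (Euc d))) : ∃ z, 0 < T.baryAff K z x := by
  by_contra! h
  have := T.sum_baryAff K x
  rw [Finset.sum_eq_zero fun z _ => le_antisymm (h z) ((T.mem_convexHull_iff K x).1 hx z)] at this
  exact zero_ne_one this

theorem baryAff_eq_zero_of_mem_facet {K : T.cells} {F : Finset (Euc d)} (hFK : F ⊆ K.1)
    {z x : Euc d} (hz : z ∉ F) (hx : x ∈ convexHull ℝ (F : Set (Euc d))) :
    T.baryAff K z x = 0 := by
  classical
  refine convexHull_min (t := {x | T.baryAff K z x = 0}) ?_ ?_ hx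
  · intro y hy
    change _ = _
    rw [T.baryAff_apply_vertex K z (hFK hy), if_neg]
    rintro rfl
    exact hz hy
  · intro a ha b hb s t _ _ hst
    change _ = _
    rw [T.baryAff_combo K z a b hst, ha, hb]
    simp

/-- A facet that is not contained in the boundary belongs to a second cell. -/
theorem exists_other_cell (hd : 2 ≤ d) (hreg : interior (closure Ω) = Ω) {K : T.cells}
    {F : Finset (Euc d)} (hF : F.card = d) (hFK : F ⊆ K.1)
    (hint : ¬ convexHull ℝ (F : Set (Euc d)) ⊆ frontier Ω) :
    ∃ K' : T.cells, K' ≠ K ∧ F ⊆ K'.1 := by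
  classical
  have hopen : IsOpen Ω := hreg ▸ isOpen_interior
  obtain ⟨x, hxF, hxf⟩ := not_subset.1 hint
  have hxK : x ∈ convexHull ℝ (K.1 : Set (Euc d)) :=
    convexHull_mono (Finset.coe_subset.2 hFK) hxF
  have hxΩ := mem_of_mem_closure_of_notMem_frontier hreg (T.cell_subset_closure K hxK) hxf
  have hFK' : (K.1 \ F).card = 1 := by
    rw [Finset.card_sdiff_of_subset hFK, T.card_eq K.1 K.2, hF]
    omega
  obtain ⟨z₀, hz₀⟩ := Finset.card_eq_one.1 hFK'
  have hz₀' : z₀ ∈ K.1 ∧ z₀ ∉ F := Finset.mem_sdiff.1 (hz₀ ▸ Finset.mem_singleton_self z₀)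
  have hd0 : (0 : ℝ) < d := by
    have : 0 < d := by omega
    exact_mod_cast this
  -- The centroid of F has all of F as its support, so it lies in Ω along with x, and every cell
  -- that contains it contains all vertices of F.
  set c : Euc d := ∑ y ∈ F, (1 / d : ℝ) • y with hc
  have hcb (z : Euc d) : T.baryAff K z c = if z ∈ F then 1 / (d : ℝ) else 0 := by
    have h1 : c = F.affineCombination ℝ (id : Euc d → Euc d) (fun _ => (1 / d : ℝ)) := by
      rw [Finset.affineCombination_eq_linear_combination]
      · simp [hc]
      · rw [Finset.sum_const, hF, nsmul_eq_mul]; field_simp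
    rw [h1, Finset.map_affineCombination _ _ _ (by
      rw [Finset.sum_const, hF, nsmul_eq_mul]; field_simp),
      Finset.affineCombination_eq_linear_combination _ _ _ (by
      rw [Finset.sum_const, hF, nsmul_eq_mul]; field_simp)]
    have h2 : ∀ y ∈ F, (1 / d : ℝ) • (T.baryAff K z ∘ id) y = if y = z then 1 / (d : ℝ) else 0 := by
      intro y hy
      simp only [Function.comp, id, T.baryAff_apply_vertex K z (hFK hy), smul_eq_mul]
      split_ifs <;> simp
    rw [Finset.sum_congr rfl h2, Finset.sum_ite_eq']
  have hcK : c ∈ convexHull ℝ (K.1 : Set (Euc d)) := by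
    rw [T.mem_convexHull_iff]
    intro z
    rw [hcb]
    split_ifs <;> positivity
  have hcΩ : c ∈ Ω := by
    refine T.mem_of_support_le hreg hxΩ hxK hcK fun z hz => ?_
    have hzF : z ∈ F := by
      by_contra hzF
      exact hz.ne' (T.baryAff_eq_zero_of_mem_facet hFK hzF hxF)
    rw [hcb, if_pos hzF]
    positivity
  -- Move from the centroid slightly away from the vertex z₀ opposite to F. The coordinate of z₀
  -- becomes -t < 0, which leaves K, while the point still lies in Ω and in a cell through c.
  have hlim : Filter.Tendsto (fun t : ℝ => (1 + t) • c + (-t) • z₀) (nhdsWithin 0 (Ioi 0))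
      (nhds c) := by
    have : Continuous fun t : ℝ => (1 + t) • c + (-t) • z₀ := by fun_prop
    have h := this.tendsto 0
    simp only [add_zero, one_smul, neg_zero, zero_smul] at h
    exact h.mono_left nhdsWithin_le_nhds
  obtain ⟨t, ⟨h1, h2⟩, h3⟩ := (((hlim.eventually (hopen.mem_nhds hcΩ)).and
    (hlim.eventually (T.eventually_mem_cell_imp c))).and self_mem_nhdsWithin).exists
  obtain ⟨K', hK'⟩ := T.exists_cell_of_mem_closure (subset_closure h1)
  refine ⟨K', ?_, fun z hz => ?_⟩
  · rintro rfl
    have := (T.mem_convexHull_iff K' _).1 hK' z₀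
    rw [T.baryAff_combo K' z₀ _ _ (by ring), hcb, if_neg hz₀'.2,
      T.baryAff_apply_vertex K' z₀ hz₀'.1, if_pos rfl] at this
    have h3' : 0 < t := h3
    linarith
  · have h := hcb z
    rw [if_pos hz, T.baryAff_eq hcK (h2 K' hK')] at h
    refine T.mem_of_baryAff_ne_zero (K := K') (x := c) ?_
    rw [h]
    positivity

/-- A property that passes between cells with a common vertex holds for all cells if it holds for
one. -/
theorem forall_cells_of_vertex_step (hconn : IsConnected Ω) (P : T.cells → Prop)
    (hstep : ∀ (K K' : T.cells) (z : Euc d), z ∈ K.1 → z ∈ K'.1 → P K → P K')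
    {K₀ : T.cells} (h₀ : P K₀) (K : T.cells) : P K := by
  by_contra hK
  have hpre : IsPreconnected (closure Ω) := hconn.isPreconnected.closure
  rw [isPreconnected_closed_iff] at hpre
  -- The cells with the property and those without it form two closed sets that cover the connected
  -- closure of Ω. They therefore meet, and conformity gives the two cells at a common point a
  -- common vertex.
  have hcl (Q : T.cells → Prop) :
      IsClosed (⋃ K : {K : T.cells // Q K}, convexHull ℝ (K.1.1 : Set (Euc d))) :=
    isClosed_iUnion_of_finite fun K => T.isClosed_cell K.1
  obtain ⟨x, -, hx1, hx2⟩ := hpre _ _ (hcl P) (hcl fun K => ¬ P K)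
    (by
      intro x hx
      obtain ⟨K, hK⟩ := T.exists_cell_of_mem_closure hx
      by_cases hP : P K
      · exact Or.inl (mem_iUnion.2 ⟨⟨K, hP⟩, hK⟩)
      · exact Or.inr (mem_iUnion.2 ⟨⟨K, hP⟩, hK⟩))
    (by
      obtain ⟨x, hx⟩ := T.interior_nonempty K₀
      have hx := interior_subset hx
      exact ⟨x, T.cell_subset_closure K₀ hx, mem_iUnion.2 ⟨⟨K₀, h₀⟩, hx⟩⟩)
    (by
      obtain ⟨x, hx⟩ := T.interior_nonempty K
      have hx := interior_subset hx
      exact ⟨x, T.cell_subset_closure K hx, mem_iUnion.2 ⟨⟨K, hK⟩, hx⟩⟩)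
  obtain ⟨⟨K₁, hP₁⟩, hx1⟩ := mem_iUnion.1 hx1
  obtain ⟨⟨K₂, hP₂⟩, hx2⟩ := mem_iUnion.1 hx2
  obtain ⟨z, hz⟩ := T.exists_vertex_baryAff_pos K₁ hx1
  have hz' := hz
  rw [T.baryAff_eq hx1 hx2] at hz'
  exact hP₂ (hstep K₁ K₂ z (T.mem_of_baryAff_ne_zero hz.ne') (T.mem_of_baryAff_ne_zero hz'.ne') hP₁)

theorem mem_facets {F : Finset (Euc d)} :
    F ∈ T.facets ↔ ∃ K : T.cells, F ⊆ K.1 ∧ F.card = d := by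
  classical
  simp [facets, Finset.mem_powersetCard, ← and_assoc]

theorem erase_mem_facets (K : T.cells) {z : Euc d} (hz : z ∈ K.1) [DecidableEq (Euc d)] :
    K.1.erase z ∈ T.facets :=
  T.mem_facets.2 ⟨K, Finset.erase_subset _ _, by
    rw [Finset.card_erase_of_mem hz, T.card_eq K.1 K.2, Nat.add_sub_cancel]⟩

theorem exists_cell (hconn : IsConnected Ω) : Nonempty T.cells := by
  obtain ⟨x, hx⟩ := hconn.nonempty
  exact ⟨(T.exists_cell_of_mem_closure (subset_closure hx)).choose⟩

/-- If all facets were on the boundary, no point of Ω could lie on a facet. Then Ω would be covered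
by the disjoint open interiors of the cells, and by connectedness by a single one of them. -/
theorem interiorFacets_nonempty (hconn : IsConnected Ω) (hreg : interior (closure Ω) = Ω)
    (hcard : 2 ≤ T.cells.card) : T.interiorFacets.Nonempty := by
  classical
  by_contra hne
  obtain ⟨K₁, h₁, K₂, h₂, hK⟩ := Finset.one_lt_card.1 hcard
  have hsub (x : Euc d) (hx : x ∈ Ω) (K : T.cells)
      (hxK : x ∈ convexHull ℝ (K.1 : Set (Euc d))) :
      x ∈ interior (convexHull ℝ (K.1 : Set (Euc d))) := by
    rw [T.mem_interior_convexHull_iff]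
    by_contra! h
    obtain ⟨z, hz, hz'⟩ := h
    have hF := T.erase_mem_facets K hz
    have hfr : convexHull ℝ ((K.1.erase z : Finset (Euc d)) : Set (Euc d)) ⊆ frontier Ω := by
      by_contra hfr
      exact hne ⟨_, Finset.mem_filter.2 ⟨hF, hfr⟩⟩
    refine notMem_of_mem_frontier hreg (hfr (T.mem_convexHull_of_support K hxK fun y hy => ?_)) hx
    rw [Finset.mem_coe, Finset.mem_erase]
    refine ⟨?_, T.mem_of_baryAff_ne_zero hy.ne'⟩
    rintro rfl
    exact absurd hy (not_lt.2 hz')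
  have hsubset : Ω ⊆ interior (convexHull ℝ (K₁ : Set (Euc d))) := by
    refine hconn.isPreconnected.subset_left_of_subset_union isOpen_interior
      (v := ⋃ K : {K : T.cells // K ≠ ⟨K₁, h₁⟩}, interior (convexHull ℝ (K.1.1 : Set (Euc d))))
      (isOpen_iUnion fun _ => isOpen_interior) ?_ ?_ ?_
    · rw [disjoint_left]
      intro x hx hx'
      obtain ⟨⟨K, hK⟩, hx'⟩ := mem_iUnion.1 hx'
      exact hK (T.eq_of_mem_interior (K := ⟨K₁, h₁⟩) hx (interior_subset hx')).symm
    · intro x hx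
      obtain ⟨K, hxK⟩ := T.exists_cell_of_mem_closure (subset_closure hx)
      by_cases hK : K = ⟨K₁, h₁⟩
      · left
        have := hsub x hx K hxK
        rwa [hK] at this
      · exact Or.inr (mem_iUnion.2 ⟨⟨K, hK⟩, hsub x hx K hxK⟩)
    · obtain ⟨x, hx⟩ := T.interior_nonempty ⟨K₁, h₁⟩
      exact ⟨x, T.interior_cell_subset hreg _ hx, hx⟩
  obtain ⟨x, hx⟩ := T.interior_nonempty ⟨K₂, h₂⟩
  have := hsubset (T.interior_cell_subset hreg _ hx)
  exact hK (congrArg Subtype.val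
    (T.eq_of_mem_interior (K := ⟨K₁, h₁⟩) (K' := ⟨K₂, h₂⟩) this (interior_subset hx)))

/-- Otherwise Ω would be the whole space, but its closure is a finite union of compact simplices. -/
theorem frontier_nonempty (T : SimplicialMesh Ω) (hd : 2 ≤ d) (hconn : IsConnected Ω) : (frontier Ω).Nonempty := by
  have : Nonempty (Fin d) := ⟨⟨0, by omega⟩⟩
  by_contra h
  rw [not_nonempty_iff_eq_empty, frontier_eq_empty_iff] at h
  rcases h with h | h
  · exact hconn.nonempty.ne_empty h
  · have hc : IsCompact (⋃ K ∈ T.cells, convexHull ℝ (K : Set (Euc d))) :=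
      T.cells.isCompact_biUnion fun K _ => K.finite_toSet.isCompact_convexHull ℝ
    rw [T.cover, h, closure_univ] at hc
    exact noncompact_univ (Euc d) hc

/-! ### Hat functions. -/

open Classical in
/-- The hat function of the point `z`. -/
noncomputable def hat (z x : Euc d) : ℝ :=
  if h : ∃ K : T.cells, x ∈ convexHull ℝ (K.1 : Set (Euc d)) then T.baryAff h.choose z x else 0

theorem hat_eq {K : T.cells} {x : Euc d} (hx : x ∈ convexHull ℝ (K.1 : Set (Euc d)))
    (z : Euc d) : T.hat z x = T.baryAff K z x := by
  have h : ∃ K : T.cells, x ∈ convexHull ℝ (K.1 : Set (Euc d)) := ⟨K, hx⟩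
  rw [hat, dif_pos h]
  exact T.baryAff_eq h.choose_spec hx z

theorem continuousOn_hat (z : Euc d) : ContinuousOn (T.hat z) (closure Ω) := by
  have : closure Ω = ⋃ K : T.cells, convexHull ℝ (K.1 : Set (Euc d)) := by
    rw [← T.cover, iUnion_subtype]
  rw [this]
  refine (locallyFinite_of_finite _).continuousOn_iUnion (fun K => T.isClosed_cell K) fun K => ?_
  exact (T.continuous_baryAff K z).continuousOn.congr fun x hx => T.hat_eq hx z

open Classical in
theorem hat_vertex {y : Euc d} (hy : y ∈ T.vertices) (z : Euc d) :
    T.hat z y = if y = z then 1 else 0 := by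
  simp only [vertices, Finset.mem_biUnion, id] at hy
  obtain ⟨K, hK, hy⟩ := hy
  rw [T.hat_eq (K := ⟨K, hK⟩) (T.vertex_mem_cell hy), T.baryAff_apply_vertex ⟨K, hK⟩ z hy]

theorem hat_eq_zero_of_mem_frontier (hreg : interior (closure Ω) = Ω) {z x : Euc d}
    (hz : z ∉ frontier Ω) (hx : x ∈ frontier Ω) : T.hat z x = 0 := by
  obtain ⟨K, hK⟩ := T.exists_cell_of_mem_closure (frontier_subset_closure hx)
  rw [T.hat_eq hK]
  by_contra h
  exact hz (T.vertex_mem_frontier hreg hK hx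
    (lt_of_le_of_ne ((T.mem_convexHull_iff K x).1 hK z) (Ne.symm h)))

end SimplicialMesh

/-! ### The function f and polynomial functions of bounded degree. -/

/-- The function `s ↦ P_k^{(0,d-2)}(1 - 2 s)`. -/
noncomputable def jac (d k : ℕ) (s : ℝ) : ℝ := (jacobiPoly 0 ((d : ℝ) - 2) k).eval (1 - 2 * s)

theorem continuous_jac (d k : ℕ) : Continuous (jac d k) :=
  (Polynomial.continuous _).comp (by fun_prop)

theorem jac_eq (m k : ℕ) (s : ℝ) : jac (m + 2) k s = (jacobiPoly 0 m k).eval (1 - 2 * s) := by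
  simp [jac]

theorem jac_zero {d : ℕ} (hd : 2 ≤ d) (k : ℕ) : jac d k 0 = 1 := by
  obtain ⟨m, rfl⟩ := Nat.exists_eq_add_of_le' hd
  rw [jac_eq, mul_zero, sub_zero, jacobiPoly_eval_one]

theorem jac_one_pos {d : ℕ} (hd : 2 ≤ d) {k : ℕ} (hk : Even k) : 0 < jac d k 1 := by
  obtain ⟨m, rfl⟩ := Nat.exists_eq_add_of_le' hd
  have := jacobiPoly_eval_neg_one_pos m hk
  rw [jac_eq]
  norm_num
  exact this

theorem jac_one_neg {d : ℕ} (hd : 2 ≤ d) {k : ℕ} (hk : Odd k) : jac d k 1 < 0 := by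
  obtain ⟨m, rfl⟩ := Nat.exists_eq_add_of_le' hd
  have := jacobiPoly_eval_neg_one_neg m hk
  rw [jac_eq]
  norm_num
  exact this

theorem jac_three_one (k : ℕ) : jac 3 k 1 = (-1) ^ k * (k + 1) := by
  have := jacobiPoly_eval_neg_one 1 k
  rw [jac_eq]
  norm_num at this ⊢
  exact this

theorem jac_degree_one {d : ℕ} (hd : 2 ≤ d) (s : ℝ) : jac d 1 s = 1 - d * s := by
  obtain ⟨m, rfl⟩ := Nat.exists_eq_add_of_le' hd
  rw [jac_eq, jacobiPoly_eval_one_sub]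
  simp [Finset.sum_range_succ]
  ring

theorem exists_jac_not_affine {d : ℕ} (hd : 2 ≤ d) {k : ℕ} (hk : 2 ≤ k) :
    ∃ a ∈ Icc (0 : ℝ) (1 / 2), jac d k (2 * a) + 1 ≠ 2 * jac d k a := by
  obtain ⟨m, rfl⟩ := Nat.exists_eq_add_of_le' hd
  simpa only [jac_eq] using exists_jacobiPoly_not_affine m hk

theorem natDegree_jacobiPoly_le (a b : ℝ) (k : ℕ) : (jacobiPoly a b k).natDegree ≤ k := by
  unfold jacobiPoly
  refine Polynomial.natDegree_sum_le_of_forall_le _ _ fun l hl => ?_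
  refine (Polynomial.natDegree_C_mul_le _ _).trans ?_
  refine Polynomial.natDegree_pow_le.trans ?_
  have : (Polynomial.C (1 / 2 : ℝ) * (Polynomial.X - 1)).natDegree ≤ 1 := by
    refine (Polynomial.natDegree_C_mul_le _ _).trans ?_
    exact (Polynomial.natDegree_X_sub_C (1 : ℝ)).le
  calc l * _ ≤ l * 1 := Nat.mul_le_mul_left _ this
    _ ≤ k := by
      rw [mul_one]
      exact Nat.lt_succ_iff.1 (Finset.mem_range.1 hl)

/-- `g` is a polynomial function of degree at most `k`. -/
def IsPolyFun {d : ℕ} (k : ℕ) (g : Euc d → ℝ) : Prop :=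
  ∃ p : MvPolynomial (Fin d) ℝ, p.totalDegree ≤ k ∧ g = polyFun p

namespace IsPolyFun

variable {d k : ℕ} {g h : Euc d → ℝ}

theorem add (hg : IsPolyFun k g) (hh : IsPolyFun k h) : IsPolyFun k (g + h) := by
  obtain ⟨p, hp, rfl⟩ := hg
  obtain ⟨q, hq, rfl⟩ := hh
  exact ⟨p + q, (MvPolynomial.totalDegree_add p q).trans (max_le hp hq), by
    ext x; simp [polyFun]⟩

theorem const_smul (hg : IsPolyFun k g) (c : ℝ) : IsPolyFun k (c • g) := by
  obtain ⟨p, hp, rfl⟩ := hg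
  exact ⟨c • p, (MvPolynomial.totalDegree_smul_le c p).trans hp, by
    ext x; simp [polyFun, MvPolynomial.smul_eval]⟩

theorem const (k : ℕ) (c : ℝ) : IsPolyFun k (fun _ : Euc d => c) :=
  ⟨MvPolynomial.C c, by simp, by ext x; simp [polyFun]⟩

theorem sum {ι : Type*} (s : Finset ι) (g : ι → Euc d → ℝ) (hg : ∀ i ∈ s, IsPolyFun k (g i)) :
    IsPolyFun k (fun x => ∑ i ∈ s, g i x) := by
  choose! p hp hp' using hg
  refine ⟨∑ i ∈ s, p i, (MvPolynomial.totalDegree_finsetSum s p).trans (Finset.sup_le hp), ?_⟩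
  ext x
  simp only [polyFun, map_sum]
  exact Finset.sum_congr rfl fun i hi => congrFun (hp' i hi) x

theorem of_affine (l : Euc d →ᵃ[ℝ] ℝ) : IsPolyFun 1 l := by
  refine ⟨MvPolynomial.C (l 0) +
    ∑ i, MvPolynomial.C (l.linear (EuclideanSpace.single i 1)) * MvPolynomial.X i, ?_, ?_⟩
  · refine (MvPolynomial.totalDegree_add _ _).trans (max_le (by simp) ?_)
    refine (MvPolynomial.totalDegree_finsetSum _ _).trans (Finset.sup_le fun i _ => ?_)
    refine (MvPolynomial.totalDegree_mul _ _).trans ?_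
    simp
  · ext x
    have hx : x = ∑ i, x i • EuclideanSpace.single i (1 : ℝ) := by
      ext j
      simp [Finset.sum_apply, Pi.single_apply]
    have h := l.map_vadd 0 x
    rw [vadd_eq_add, add_zero, vadd_eq_add] at h
    rw [h]
    nth_rw 1 [hx]
    simp only [map_sum, map_smul, smul_eq_mul, polyFun, map_add, map_mul, MvPolynomial.eval_C,
      MvPolynomial.eval_X]
    rw [add_comm]
    congr 1
    exact Finset.sum_congr rfl fun i _ => mul_comm _ _

theorem comp_polynomial (Q : Polynomial ℝ) (hQ : Q.natDegree ≤ k) (hg : IsPolyFun 1 g) :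
    IsPolyFun k (fun x => Q.eval (g x)) := by
  obtain ⟨p, hp, rfl⟩ := hg
  refine ⟨∑ i ∈ Finset.range (k + 1), MvPolynomial.C (Q.coeff i) * p ^ i, ?_, ?_⟩
  · refine (MvPolynomial.totalDegree_finsetSum _ _).trans (Finset.sup_le fun i hi => ?_)
    refine (MvPolynomial.totalDegree_mul _ _).trans ?_
    rw [MvPolynomial.totalDegree_C, zero_add]
    refine (MvPolynomial.totalDegree_pow _ _).trans ?_
    calc i * p.totalDegree ≤ i * 1 := Nat.mul_le_mul_left _ hp
      _ ≤ k := by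
        rw [mul_one]
        exact Nat.lt_succ_iff.1 (Finset.mem_range.1 hi)
  · ext x
    rw [Polynomial.eval_eq_sum_range' (Nat.lt_succ_iff.2 hQ)]
    simp [polyFun]

theorem jac_affine (k : ℕ) (l : Euc d →ᵃ[ℝ] ℝ) : IsPolyFun k (fun x => jac d k (l x)) := by
  refine comp_polynomial (g := fun x => 1 - 2 * l x) _ (natDegree_jacobiPoly_le _ _ k) ?_
  have := (const 1 (1 : ℝ)).add ((of_affine l).const_smul (-2))
  convert this using 1
  ext x
  simp
  ring

end IsPolyFun

/-! ### Restrictions of L² classes to cells, and the shape functions there. -/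

namespace SimplicialMesh

variable {d : ℕ} {Ω : Set (Euc d)} (T : SimplicialMesh Ω)

section Restriction

variable {v w : L2 Ω} {K : Finset (Euc d)} {g h : Euc d → ℝ}

theorem IsRestriction.add (hv : IsRestriction v K g) (hw : IsRestriction w K h) :
    IsRestriction (v + w) K (g + h) :=
  ⟨hv.1.add hw.1, Filter.EventuallyEq.trans (ae_restrict_of_ae (Lp.coeFn_add v w)) (hv.2.add hw.2)⟩

theorem IsRestriction.const_smul (hv : IsRestriction v K g) (c : ℝ) :
    IsRestriction (c • v) K (c • g) :=
  ⟨hv.1.const_smul c, Filter.EventuallyEq.trans (ae_restrict_of_ae (Lp.coeFn_smul c v)) (hv.2.const_smul c)⟩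

theorem isRestriction_zero (K : Finset (Euc d)) : IsRestriction (0 : L2 Ω) K 0 :=
  ⟨continuousOn_const, ae_restrict_of_ae (Lp.coeFn_zero _ _ _)⟩

theorem IsRestriction.sum {ι : Type*} (s : Finset ι) (v : ι → L2 Ω) (g : ι → Euc d → ℝ)
    (hv : ∀ i ∈ s, IsRestriction (v i) K (g i)) :
    IsRestriction (∑ i ∈ s, v i) K (fun x => ∑ i ∈ s, g i x) := by
  classical
  induction s using Finset.induction_on with
  | empty =>
    simp only [Finset.sum_empty]
    exact isRestriction_zero K
  | insert i s hi ih =>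
    simp only [Finset.sum_insert hi]
    exact (hv i (Finset.mem_insert_self i s)).add
      (ih fun j hj => hv j (Finset.mem_insert_of_mem hj))

theorem IsRestriction.congr (hv : IsRestriction v K g)
    (hgh : EqOn g h (convexHull ℝ (K : Set (Euc d)))) : IsRestriction v K h := by
  refine ⟨hv.1.congr hgh.symm, hv.2.trans ?_⟩
  filter_upwards [ae_restrict_mem isOpen_interior.measurableSet] with x hx
  exact hgh (interior_subset hx)

end Restriction

theorem restrict_restrict_interior (hreg : interior (closure Ω) = Ω) (K : T.cells) :
    (volume.restrict Ω).restrict (interior (convexHull ℝ (K.1 : Set (Euc d)))) =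
      volume.restrict (interior (convexHull ℝ (K.1 : Set (Euc d)))) := by
  rw [Measure.restrict_restrict isOpen_interior.measurableSet,
    inter_eq_left.2 (T.interior_cell_subset hreg K)]

/-- The interior of a cell lies in Ω, so two restrictions agree almost everywhere on an open set,
then everywhere on it by continuity, and finally on the closed cell. This gives point values, in
particular at vertices, to elements of L². -/
theorem IsRestriction.unique {T : SimplicialMesh Ω} (hreg : interior (closure Ω) = Ω) {v : L2 Ω}
    {K : T.cells} {g h : Euc d → ℝ} (hg : IsRestriction v K.1 g) (hh : IsRestriction v K.1 h) :
    EqOn g h (convexHull ℝ (K.1 : Set (Euc d))) := by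
  have hae : g =ᵐ[volume.restrict (interior (convexHull ℝ (K.1 : Set (Euc d))))] h := by
    rw [← T.restrict_restrict_interior hreg K]
    exact hg.2.symm.trans hh.2
  have := Measure.eqOn_open_of_ae_eq hae isOpen_interior (hg.1.mono interior_subset)
    (hh.1.mono interior_subset)
  exact this.of_subset_closure hg.1 hh.1 interior_subset (T.closure_interior_cell K).ge

/-- The boundary of a convex set is a null set, and there are finitely many cells. -/
theorem ae_mem_interior_cell :
    ∀ᵐ x ∂(volume.restrict Ω), ∃ K : T.cells,
      x ∈ interior (convexHull ℝ (K.1 : Set (Euc d))) := by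
  have h : ∀ᵐ x ∂(volume : Measure (Euc d)), ∀ K : T.cells,
      x ∉ frontier (convexHull ℝ (K.1 : Set (Euc d))) := by
    rw [ae_all_iff]
    intro K
    exact measure_eq_zero_iff_ae_notMem.1 ((convex_convexHull ℝ _).addHaar_frontier volume)
  have hsub : volume.restrict Ω ≤ volume.restrict (closure Ω) :=
    Measure.restrict_mono subset_closure le_rfl
  refine hsub.absolutelyContinuous.ae_le ?_
  filter_upwards [ae_restrict_of_ae h, ae_restrict_mem isClosed_closure.measurableSet] with x hx hxΩ
  obtain ⟨K, hK⟩ := T.exists_cell_of_mem_closure hxΩ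
  refine ⟨K, ?_⟩
  by_contra hK'
  exact hx K ⟨subset_closure hK, hK'⟩

theorem ae_eq_of_forall_isRestriction {v : L2 Ω} {g : Euc d → ℝ}
    (h : ∀ K : T.cells, IsRestriction v K.1 g) : v =ᵐ[volume.restrict Ω] g := by
  have h' : ∀ᵐ x ∂(volume.restrict Ω), ∀ K : T.cells,
      x ∈ interior (convexHull ℝ (K.1 : Set (Euc d))) → v x = g x := by
    rw [ae_all_iff]
    intro K
    exact (ae_restrict_iff' isOpen_interior.measurableSet).1 (h K).2
  filter_upwards [h', T.ae_mem_interior_cell] with x hx ⟨K, hK⟩ using hx K hK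

theorem eq_of_forall_isRestriction {v w : L2 Ω}
    (h : ∀ K : T.cells, ∃ g, IsRestriction v K.1 g ∧ IsRestriction w K.1 g) : v = w := by
  refine Lp.ext ?_
  have h' : ∀ᵐ x ∂(volume.restrict Ω), ∀ K : T.cells,
      x ∈ interior (convexHull ℝ (K.1 : Set (Euc d))) → v x = w x := by
    rw [ae_all_iff]
    intro K
    obtain ⟨g, hv, hw⟩ := h K
    exact (ae_restrict_iff' isOpen_interior.measurableSet).1 (hv.2.trans hw.2.symm)
  filter_upwards [h', T.ae_mem_interior_cell] with x hx ⟨K, hK⟩ using hx K hK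

theorem IsConformingRep.isRestriction {T : SimplicialMesh Ω} {k : ℕ} {v : L2 Ω} {u : Euc d → ℝ}
    (hu : T.IsConformingRep k v u) (K : T.cells) : IsRestriction v K.1 u :=
  ⟨hu.1.mono (T.cell_subset_closure K), ae_restrict_of_ae hu.2.1⟩

theorem isConformingRep_of_forall_isRestriction {k : ℕ} {v : L2 Ω} {u : Euc d → ℝ}
    (hc : ContinuousOn u (closure Ω)) (h : ∀ K : T.cells, IsRestriction v K.1 u)
    (hp : ∀ K : T.cells, ∃ g, IsPolyFun k g ∧ EqOn u g (convexHull ℝ (K.1 : Set (Euc d)))) :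
    T.IsConformingRep k v u := by
  refine ⟨hc, T.ae_eq_of_forall_isRestriction h, fun K hK => ?_⟩
  obtain ⟨_, ⟨p, hp, rfl⟩, h⟩ := hp ⟨K, hK⟩
  exact ⟨p, hp, h⟩

theorem isRestriction_toLp_self (K : T.cells) {g : Euc d → ℝ} (hg : Continuous g) :
    IsRestriction (memLp_indicator_convexHull Ω K.1 hg).toLp K.1 g := by
  refine ⟨hg.continuousOn, Filter.EventuallyEq.trans (ae_restrict_of_ae (MemLp.coeFn_toLp _)) ?_⟩
  filter_upwards [ae_restrict_mem isOpen_interior.measurableSet] with x hx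
  exact indicator_of_mem (interior_subset hx) g

theorem isRestriction_toLp_of_ne {K K' : T.cells} (hne : K ≠ K') {g : Euc d → ℝ}
    (hg : Continuous g) :
    IsRestriction (memLp_indicator_convexHull Ω K.1 hg).toLp K'.1 0 := by
  refine ⟨continuousOn_const, Filter.EventuallyEq.trans (ae_restrict_of_ae (MemLp.coeFn_toLp _)) ?_⟩
  filter_upwards [ae_restrict_mem isOpen_interior.measurableSet] with x hx
  exact indicator_of_notMem (fun h => hne (T.eq_of_mem_interior hx h).symm) g

open Classical in
theorem isRestriction_cellFun (k : ℕ) (K K' : T.cells) :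
    IsRestriction (T.cellFun k K) K'.1 (if K = K' then T.cellShape k K' else 0) := by
  split_ifs with h
  · subst h
    exact T.isRestriction_toLp_self K (T.continuous_cellShape k K)
  · exact T.isRestriction_toLp_of_ne h (T.continuous_cellShape k K)

open Classical in
theorem isRestriction_facetFun (k : ℕ) (F : Finset (Euc d)) (K : T.cells) :
    IsRestriction (T.facetFun k F) K.1 (if F ⊆ K.1 then T.facetShape k F K else 0) := by
  have := IsRestriction.sum (K := K.1) (Finset.univ.filter fun K : T.cells => F ⊆ K.1)
    (fun K' : T.cells => (memLp_indicator_convexHull Ω K'.1 (T.continuous_facetShape k F K')).toLp)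
    (fun K' => if K' = K then T.facetShape k F K else 0) (fun K' _ => by
      split_ifs with h
      · subst h
        exact T.isRestriction_toLp_self K' (T.continuous_facetShape k F K')
      · exact T.isRestriction_toLp_of_ne h (T.continuous_facetShape k F K'))
  refine this.congr fun x _ => ?_
  have e (K' : T.cells) : (if K' = K then T.facetShape k F K else 0) x =
      if K' = K then T.facetShape k F K x else 0 := by split_ifs <;> rfl
  simp only [e, Finset.sum_ite_eq', Finset.mem_filter, Finset.mem_univ, true_and]
  split_ifs <;> rfl

theorem jacobiBary_eq (k : ℕ) (K : T.cells) (z : K.1) (x : Euc d) :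
    T.jacobiBary k K z x = jac d k (T.baryAff K z x) := by
  rw [jacobiBary, jac, baryAff_of_mem]

theorem cellShape_eq (k : ℕ) (K : T.cells) (x : Euc d) :
    T.cellShape k K x = 1 / d * (-1 + ∑ z ∈ K.1, jac d k (T.baryAff K z x)) := by
  simp only [cellShape, jacobiBary_eq]
  rw [Finset.sum_coe_sort K.1 fun z => jac d k (T.baryAff K z x)]

open Classical in
theorem facetShape_erase (k : ℕ) (K : T.cells) {z : Euc d} (hz : z ∈ K.1) (x : Euc d) :
    T.facetShape k (K.1.erase z) K x = jac d k (T.baryAff K z x) - T.cellShape k K x := by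
  simp only [facetShape, jacobiBary_eq]
  congr 1
  rw [Finset.sum_coe_sort K.1 fun y =>
    if y ∈ K.1.erase z then 0 else jac d k (T.baryAff K y x)]
  rw [Finset.sum_eq_single_of_mem z hz]
  · simp
  · intro y hy hyz
    rw [if_pos (Finset.mem_erase.2 ⟨hyz, hy⟩)]

theorem isPolyFun_cellShape (k : ℕ) (K : T.cells) : IsPolyFun k (T.cellShape k K) := by
  have h := ((IsPolyFun.const k (-1 : ℝ)).add (IsPolyFun.sum K.1
    (fun z x => jac d k (T.baryAff K z x)) fun z _ => IsPolyFun.jac_affine k _)).const_smul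
    (1 / d : ℝ)
  convert h using 1
  ext x
  simp [cellShape_eq]

open Classical in
/-- A facet of the mesh contained in the cell `K` is obtained by removing a vertex. -/
theorem exists_eq_erase {K : T.cells} {F : Finset (Euc d)} (hF : F.card = d) (hFK : F ⊆ K.1) :
    ∃ z ∈ K.1, F = K.1.erase z := by
  have h : (K.1 \ F).card = 1 := by
    rw [Finset.card_sdiff_of_subset hFK, T.card_eq K.1 K.2, hF]
    omega
  obtain ⟨z, hz⟩ := Finset.card_eq_one.1 h
  have hz' := Finset.mem_sdiff.1 (hz ▸ Finset.mem_singleton_self z)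
  refine ⟨z, hz'.1, ?_⟩
  rw [Finset.erase_eq, ← hz, Finset.sdiff_sdiff_eq_self hFK]

open Classical in
theorem sum_facets_of_cell (K : T.cells) (f : Finset (Euc d) → ℝ) :
    ∑ F ∈ T.facets with F ⊆ K.1, f F = ∑ z ∈ K.1, f (K.1.erase z) := by
  symm
  refine Finset.sum_bij (fun z _ => K.1.erase z) ?_ ?_ ?_ (fun _ _ => rfl)
  · intro z hz
    exact Finset.mem_filter.2 ⟨T.erase_mem_facets K hz, Finset.erase_subset _ _⟩
  · intro y hy z hz h
    by_contra hne
    have : y ∈ K.1.erase z := Finset.mem_erase.2 ⟨hne, hy⟩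
    rw [← h] at this
    exact Finset.notMem_erase y _ this
  · intro F hF
    obtain ⟨hF, hFK⟩ := Finset.mem_filter.1 hF
    obtain ⟨-, -, hc⟩ := T.mem_facets.1 hF
    obtain ⟨z, hz, rfl⟩ := T.exists_eq_erase hc hFK
    exact ⟨z, hz, rfl⟩

open Classical in
/-- The restriction to a cell of a linear combination of facet functions. -/
theorem isRestriction_facetSum (k : ℕ) (a : Finset (Euc d) → ℝ) (K : T.cells) :
    IsRestriction (∑ F ∈ T.facets, a F • T.facetFun k F) K.1 fun x =>
      ∑ z ∈ K.1, a (K.1.erase z) * (jac d k (T.baryAff K z x) - T.cellShape k K x) := by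
  refine (IsRestriction.sum T.facets _ _
    fun F _ => (T.isRestriction_facetFun k F K).const_smul (a F)).congr fun x _ => ?_
  have e (F : Finset (Euc d)) : (a F • if F ⊆ K.1 then T.facetShape k F K else 0) x =
      if F ⊆ K.1 then a F * T.facetShape k F K x else 0 := by split_ifs <;> simp
  simp only [e]
  rw [← Finset.sum_filter, T.sum_facets_of_cell K fun F => a F * T.facetShape k F K x]
  refine Finset.sum_congr rfl fun z hz => ?_
  rw [T.facetShape_erase k K hz]

open Classical in
/-- The restriction to a cell of a linear combination of simplex functions. -/
theorem isRestriction_cellSum (k : ℕ) (c : T.cells → ℝ) (K : T.cells) :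
    IsRestriction (∑ K', c K' • T.cellFun k K') K.1 (c K • T.cellShape k K) := by
  refine (IsRestriction.sum Finset.univ _ _
    fun K' _ => (T.isRestriction_cellFun k K' K).const_smul (c K')).congr fun x _ => ?_
  have e (K' : T.cells) : (c K' • if K' = K then T.cellShape k K else 0) x =
      if K' = K then c K' * T.cellShape k K x else 0 := by split_ifs <;> simp
  simp [e]

/-- Every element of the span of facet functions is a combination of all facet functions with
coefficients that vanish off the given facets. -/
theorem exists_coeff_of_mem_Vfacet {k : ℕ} {A : Finset (Finset (Euc d))} (hA : A ⊆ T.facets)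
    {v : L2 Ω} (hv : v ∈ T.Vfacet k A) :
    ∃ a : Finset (Euc d) → ℝ, (∀ F, F ∉ A → a F = 0) ∧
      ∑ F ∈ T.facets, a F • T.facetFun k F = v := by
  classical
  rw [Vfacet, Submodule.mem_span_image_finset_iff_exists_fun'] at hv
  obtain ⟨c, hc⟩ := hv
  refine ⟨fun F => if F ∈ A then c F else 0, fun F hF => if_neg hF, ?_⟩
  rw [← hc, ← Finset.sum_subset hA fun F _ hF => by simp only [if_neg hF, zero_smul]]
  exact Finset.sum_congr rfl fun F hF => by simp only [if_pos hF]

theorem facetSum_mem_Vfacet {k : ℕ} {A : Finset (Finset (Euc d))}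
    {a : Finset (Euc d) → ℝ} (ha : ∀ F ∈ T.facets, F ∉ A → a F = 0) :
    ∑ F ∈ T.facets, a F • T.facetFun k F ∈ T.Vfacet k A := by
  refine Submodule.sum_mem _ fun F hF => ?_
  by_cases hFA : F ∈ A
  · exact Submodule.smul_mem _ _ (Submodule.subset_span ⟨F, hFA, rfl⟩)
  · rw [ha F hF hFA, zero_smul]
    exact zero_mem _

open Classical in
theorem facetSum_single (k : ℕ) {F : Finset (Euc d)} (hF : F ∈ T.facets) :
    ∑ F' ∈ T.facets, (if F' = F then (1 : ℝ) else 0) • T.facetFun k F' = T.facetFun k F := by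
  simp [hF]

theorem exists_coeff_of_mem_Vcell {k : ℕ} {T' : Set T.cells} {v : L2 Ω}
    (hv : v ∈ T.Vcell k T') :
    ∃ c : T.cells → ℝ, (∀ K, K ∉ T' → c K = 0) ∧ ∑ K, c K • T.cellFun k K = v := by
  classical
  have e : T' = ((Finset.univ.filter (· ∈ T') : Finset T.cells) : Set T.cells) := by simp
  rw [Vcell, e, Submodule.mem_span_image_finset_iff_exists_fun'] at hv
  obtain ⟨c, hc⟩ := hv
  refine ⟨fun K => if K ∈ T' then c K else 0, fun K hK => if_neg hK, ?_⟩
  rw [← hc, Finset.sum_filter]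
  refine Finset.sum_congr rfl fun K _ => ?_
  by_cases hK : K ∈ T'
  · simp only [if_pos hK]
  · simp only [if_neg hK, zero_smul]

open Classical in
theorem cellSum_single (k : ℕ) (K : T.cells) :
    ∑ K', (if K' = K then (1 : ℝ) else 0) • T.cellFun k K' = T.cellFun k K := by
  simp

/-! ### Values at the vertices -/

theorem sum_eq_add_sum_erase [DecidableEq (Euc d)] {K : T.cells} {z : Euc d} (hz : z ∈ K.1)
    (f : Euc d → ℝ) : ∑ y ∈ K.1, f y = f z + ∑ y ∈ K.1.erase z, f y :=
  (Finset.add_sum_erase _ _ hz).symm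

theorem cellShape_vertex (hd : 2 ≤ d) (k : ℕ) {K : T.cells} {y : Euc d} (hy : y ∈ K.1) :
    T.cellShape k K y = (d - 1 + jac d k 1) / d := by
  classical
  have hd0 : (d : ℝ) ≠ 0 := by
    have : d ≠ 0 := by omega
    exact_mod_cast this
  rw [cellShape_eq, T.sum_eq_add_sum_erase hy, T.baryAff_apply_vertex K y hy, if_pos rfl,
    Finset.sum_congr rfl (g := fun _ => (1 : ℝ)) (fun z hz => by
      rw [T.baryAff_apply_vertex K z hy, if_neg (Finset.ne_of_mem_erase hz).symm, jac_zero hd])]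
  rw [Finset.sum_const, Finset.card_erase_of_mem hy, T.card_eq K.1 K.2, Nat.add_sub_cancel,
    nsmul_eq_mul]
  field_simp
  ring

open Classical in
-- At y the function f of a coordinate is J for y itself and 1 for the other vertices. Subtracting
-- the value (d-1+J)/d of the simplex function leaves (1-J)/d for each facet through y and
-- (1-J)(1-d)/d for the facet opposite to y.
theorem facetSum_vertex (hd : 2 ≤ d) (k : ℕ) (a : Finset (Euc d) → ℝ) {K : T.cells} {y : Euc d}
    (hy : y ∈ K.1) :
    ∑ z ∈ K.1, a (K.1.erase z) * (jac d k (T.baryAff K z y) - T.cellShape k K y) =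
      (1 - jac d k 1) / d * (∑ z ∈ K.1, a (K.1.erase z) - d * a (K.1.erase y)) := by
  have hd0 : (d : ℝ) ≠ 0 := by
    have : d ≠ 0 := by omega
    exact_mod_cast this
  rw [T.cellShape_vertex hd k hy, T.sum_eq_add_sum_erase hy, T.sum_eq_add_sum_erase hy,
    T.baryAff_apply_vertex K y hy, if_pos rfl,
    Finset.sum_congr rfl (g := fun z => a (K.1.erase z) * ((1 - jac d k 1) / d)) (fun z hz => by
      rw [T.baryAff_apply_vertex K z hy, if_neg (Finset.ne_of_mem_erase hz).symm, jac_zero hd]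
      congr 1
      field_simp
      ring), ← Finset.sum_mul]
  field_simp
  ring

open Classical in
/-- A combination of facet functions that vanishes at the vertices of a cell has vanishing
coefficients on the facets of the cell. -/
theorem coeff_eq_zero_of_vertex (hd : 2 ≤ d) {k : ℕ} (hJ : jac d k 1 ≠ 1)
    (a : Finset (Euc d) → ℝ) (K : T.cells)
    (h : ∀ y ∈ K.1, ∑ z ∈ K.1, a (K.1.erase z) *
      (jac d k (T.baryAff K z y) - T.cellShape k K y) = 0) :
    ∀ y ∈ K.1, a (K.1.erase y) = 0 := by
  have hd0 : (d : ℝ) ≠ 0 := by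
    have : d ≠ 0 := by omega
    exact_mod_cast this
  set s := ∑ z ∈ K.1, a (K.1.erase z) with hs
  have h1 : ∀ y ∈ K.1, d * a (K.1.erase y) = s := by
    intro y hy
    have := h y hy
    rw [T.facetSum_vertex hd k a hy, mul_eq_zero] at this
    rcases this with this | this
    · rw [div_eq_zero_iff, sub_eq_zero] at this
      rcases this with this | this
      · exact absurd this.symm hJ
      · exact absurd this hd0
    · linarith
  -- All d + 1 coefficients equal s/d, and s is their sum; this forces s = 0.
  have h2 : (d : ℝ) * s = (d + 1) * s := by
    nth_rw 1 [hs]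
    rw [Finset.mul_sum, Finset.sum_congr rfl h1, Finset.sum_const, T.card_eq K.1 K.2, nsmul_eq_mul]
    push_cast
    ring
  have h3 : s = 0 := by linarith
  intro y hy
  have := h1 y hy
  rw [h3, mul_eq_zero] at this
  exact this.resolve_left hd0

theorem facetSum_coeff_eq_zero (hd : 2 ≤ d) (hreg : interior (closure Ω) = Ω) {k : ℕ}
    (hJ : jac d k 1 ≠ 1) (a : Finset (Euc d) → ℝ) {u : Euc d → ℝ}
    (hu : ∀ K : T.cells, IsRestriction (∑ F ∈ T.facets, a F • T.facetFun k F) K.1 u)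
    (hu0 : ∀ y ∈ T.vertices, u y = 0) {F : Finset (Euc d)} (hF : F ∈ T.facets) : a F = 0 := by
  classical
  obtain ⟨K, hFK, hFc⟩ := T.mem_facets.1 hF
  obtain ⟨y, hy, rfl⟩ := T.exists_eq_erase hFc hFK
  refine T.coeff_eq_zero_of_vertex hd hJ a K (fun y hy => ?_) y hy
  rw [← hu0 y (Finset.mem_biUnion.2 ⟨K.1, K.2, hy⟩)]
  exact (T.isRestriction_facetSum k a K).unique hreg (hu K) (T.vertex_mem_cell hy)

theorem disjoint_Sdot_Vfacet (hd : 2 ≤ d) (hreg : interior (closure Ω) = Ω) {k : ℕ}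
    (hJ : jac d k 1 ≠ 1) : Disjoint (T.Sdot k) (T.Vfacet k T.facets) := by
  rw [Submodule.disjoint_def]
  rintro v ⟨u, hu, hu0⟩ hv
  obtain ⟨a, -, rfl⟩ := T.exists_coeff_of_mem_Vfacet Finset.Subset.rfl hv
  refine Finset.sum_eq_zero fun F hF => ?_
  rw [T.facetSum_coeff_eq_zero hd hreg hJ a (fun K => hu.isRestriction K) hu0 hF, zero_smul]

theorem isBasisOf_facetFun (hd : 2 ≤ d) (hreg : interior (closure Ω) = Ω) {k : ℕ}
    (hJ : jac d k 1 ≠ 1) {A : Finset (Finset (Euc d))} (hA : A ⊆ T.facets) :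
    IsBasisOf (fun F : A => T.facetFun k F) (T.Vfacet k A) := by
  classical
  refine ⟨?_, ?_⟩
  · rw [Fintype.linearIndependent_iff]
    intro g hg F
    let a : Finset (Euc d) → ℝ := fun F => if h : F ∈ A then g ⟨F, h⟩ else 0
    have ha : ∑ F ∈ T.facets, a F • T.facetFun k F = 0 := by
      rw [← hg, ← Finset.sum_subset hA fun F _ hF => by simp only [a, dif_neg hF, zero_smul],
        ← Finset.sum_coe_sort]
      refine Finset.sum_congr rfl fun F _ => ?_
      simp only [a, dif_pos F.2]
    have := T.facetSum_coeff_eq_zero hd hreg hJ a (u := 0)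
      (fun K => by rw [ha]; exact isRestriction_zero K.1) (fun _ _ => rfl) (hA F.2)
    simpa only [a, dif_pos F.2] using this
  · rw [Vfacet, image_eq_range]
    rfl

/-! ### Combinations of simplex functions -/

/-- If a combination of simplex functions is conforming, the coefficients agree. -/
theorem cellSum_coeff_eq (hd : 2 ≤ d) (hconn : IsConnected Ω) (hreg : interior (closure Ω) = Ω)
    {k : ℕ} (hJ : (d : ℝ) - 1 + jac d k 1 ≠ 0) (c : T.cells → ℝ) {u : Euc d → ℝ}
    (hu : ∀ K : T.cells, IsRestriction (∑ K, c K • T.cellFun k K) K.1 u) (K K' : T.cells) :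
    c K = c K' := by
  have hd0 : (d : ℝ) ≠ 0 := by
    have : d ≠ 0 := by omega
    exact_mod_cast this
  -- At a common vertex the continuous function has one value, and both simplex functions have the
  -- same nonzero value (d-1+J)/d.
  refine T.forall_cells_of_vertex_step hconn (fun K => c K = c K') ?_ (K₀ := K') rfl K
  intro K₁ K₂ z h₁ h₂ hP
  have e (K : T.cells) (hz : z ∈ K.1) : c K * ((d - 1 + jac d k 1) / d) = u z := by
    have := (T.isRestriction_cellSum k c K).unique hreg (hu K) (T.vertex_mem_cell hz)
    rwa [Pi.smul_apply, T.cellShape_vertex hd k hz, smul_eq_mul] at this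
  have h3 := (e K₁ h₁).trans (e K₂ h₂).symm
  rw [← hP]
  exact (mul_right_cancel₀ (div_ne_zero hJ hd0) h3).symm

/-- All coefficients agree, and the one of a cell with a vertex on the boundary vanishes because the
function is zero at that vertex. -/
theorem cellSum_coeff_eq_zero (hd : 2 ≤ d) (hconn : IsConnected Ω)
    (hreg : interior (closure Ω) = Ω) {k : ℕ} (hJ : (d : ℝ) - 1 + jac d k 1 ≠ 0)
    (c : T.cells → ℝ) (h : ∑ K, c K • T.cellFun k K ∈ T.S0 k) (K : T.cells) : c K = 0 := by
  have hd0 : (d : ℝ) ≠ 0 := by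
    have : d ≠ 0 := by omega
    exact_mod_cast this
  obtain ⟨u, hu, hu0⟩ := h
  obtain ⟨x, hx⟩ := frontier_nonempty T hd hconn
  obtain ⟨K₀, hK₀⟩ := T.exists_cell_of_mem_closure (frontier_subset_closure hx)
  obtain ⟨z, hz⟩ := T.exists_vertex_baryAff_pos K₀ hK₀
  have hzK := T.mem_of_baryAff_ne_zero hz.ne'
  have := (T.isRestriction_cellSum k c K₀).unique hreg (hu.isRestriction K₀)
    (T.vertex_mem_cell hzK)
  rw [Pi.smul_apply, T.cellShape_vertex hd k hzK, smul_eq_mul,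
    hu0 z (T.vertex_mem_frontier hreg hK₀ hx hz), mul_eq_zero] at this
  rw [T.cellSum_coeff_eq hd hconn hreg hJ c (fun K => hu.isRestriction K) K K₀]
  exact this.resolve_right (div_ne_zero hJ hd0)

theorem disjoint_S0_Vcell (hd : 2 ≤ d) (hconn : IsConnected Ω)
    (hreg : interior (closure Ω) = Ω) {k : ℕ} (hJ : (d : ℝ) - 1 + jac d k 1 ≠ 0) :
    Disjoint (T.S0 k) (T.Vcell k univ) := by
  rw [Submodule.disjoint_def]
  rintro v hv hv'
  obtain ⟨c, -, rfl⟩ := T.exists_coeff_of_mem_Vcell hv'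
  refine Finset.sum_eq_zero fun K _ => ?_
  rw [T.cellSum_coeff_eq_zero hd hconn hreg hJ c hv, zero_smul]

theorem disjoint_S_Vcell (hd : 2 ≤ d) (hconn : IsConnected Ω)
    (hreg : interior (closure Ω) = Ω) {k : ℕ} (hJ : (d : ℝ) - 1 + jac d k 1 ≠ 0)
    {T' : Set T.cells} {K₀ : T.cells} (hK₀ : K₀ ∉ T') :
    Disjoint (T.S k) (T.Vcell k T') := by
  rw [Submodule.disjoint_def]
  rintro v ⟨u, hu, -⟩ hv'
  obtain ⟨c, hc, rfl⟩ := T.exists_coeff_of_mem_Vcell hv'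
  refine Finset.sum_eq_zero fun K _ => ?_
  rw [T.cellSum_coeff_eq hd hconn hreg hJ c (fun K => hu.isRestriction K) K K₀, hc K₀ hK₀,
    zero_smul]

/-- For `k ≥ 2` the simplex functions do not vanish. -/
theorem exists_cellShape_ne_zero (hd : 2 ≤ d) {k : ℕ} (hk : 2 ≤ k) (K : T.cells) :
    ∃ x ∈ convexHull ℝ (K.1 : Set (Euc d)), T.cellShape k K x ≠ 0 := by
  classical
  have hd0 : (d : ℝ) ≠ 0 := by
    have : d ≠ 0 := by omega
    exact_mod_cast this
  obtain ⟨a, ⟨ha0, ha1⟩, ha⟩ := exists_jac_not_affine hd hk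
  obtain ⟨z₀, z₁, z₂, h₀, h₁, h₂, h01, h02, h12⟩ :=
    Finset.two_lt_card_iff.1 (show 2 < K.1.card by rw [T.card_eq K.1 K.2]; omega)
  have hconv := convex_convexHull ℝ (K.1 : Set (Euc d))
  by_contra! hzero
  -- Compare two points with weight 1 - 2a at z₀: one splits the remaining weight 2a equally between
  -- z₁ and z₂, the other gives all of it to z₁. If the simplex function vanished at both, then 2
  -- f(a) = f(2a) + f(0), against the choice of a.
  have hm : (1 / 2 : ℝ) • z₁ + (1 / 2 : ℝ) • z₂ ∈ convexHull ℝ (K.1 : Set (Euc d)) :=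
    hconv (T.vertex_mem_cell h₁) (T.vertex_mem_cell h₂) (by norm_num) (by norm_num) (by norm_num)
  have e1 := hzero _ (hconv (T.vertex_mem_cell h₀) hm (a := 1 - 2 * a) (b := 2 * a) (by linarith)
    (by linarith) (by ring))
  have e2 := hzero _ (hconv (T.vertex_mem_cell h₀) (T.vertex_mem_cell h₁) (a := 1 - 2 * a)
    (b := 2 * a) (by linarith) (by linarith) (by ring))
  rw [cellShape_eq] at e1 e2
  have hd1 : (1 / d : ℝ) ≠ 0 := one_div_ne_zero hd0
  have e3 := add_left_cancel (((mul_eq_zero.1 e1).resolve_left hd1).trans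
    ((mul_eq_zero.1 e2).resolve_left hd1).symm)
  rw [← sub_eq_zero, ← Finset.sum_sub_distrib] at e3
  have hb1 (z : Euc d) : T.baryAff K z ((1 - 2 * a) • z₀ +
      (2 * a) • ((1 / 2 : ℝ) • z₁ + (1 / 2 : ℝ) • z₂)) =
      (1 - 2 * a) * (if z₀ = z then 1 else 0) + a * (if z₁ = z then 1 else 0) +
        a * (if z₂ = z then 1 else 0) := by
    rw [T.baryAff_combo K z _ _ (by ring), T.baryAff_combo K z _ _ (by norm_num),
      T.baryAff_apply_vertex K z h₀, T.baryAff_apply_vertex K z h₁, T.baryAff_apply_vertex K z h₂]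
    ring
  have hb2 (z : Euc d) : T.baryAff K z ((1 - 2 * a) • z₀ + (2 * a) • z₁) =
      (1 - 2 * a) * (if z₀ = z then 1 else 0) + (2 * a) * (if z₁ = z then 1 else 0) := by
    rw [T.baryAff_combo K z _ _ (by ring),
      T.baryAff_apply_vertex K z h₀, T.baryAff_apply_vertex K z h₁]
  simp only [hb1, hb2] at e3
  rw [← Finset.sum_subset (s₁ := {z₁, z₂}) (by
      intro z hz
      rcases Finset.mem_insert.1 hz with rfl | hz
      · exact h₁
      · rwa [Finset.mem_singleton.1 hz]) (by
      intro z _ hz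
      simp only [Finset.mem_insert, Finset.mem_singleton, not_or] at hz
      rw [if_neg (Ne.symm hz.1), if_neg (Ne.symm hz.2)]
      simp), Finset.sum_pair h12] at e3
  simp only [if_pos, if_neg h01, if_neg h02, if_neg h12, if_neg h12.symm, mul_zero, mul_one,
    zero_add, add_zero, jac_zero hd] at e3
  exact ha (by linarith)

theorem isBasisOf_cellFun (hd : 2 ≤ d) (hreg : interior (closure Ω) = Ω) {k : ℕ} (hk : 2 ≤ k) :
    IsBasisOf (fun K : T.cells => T.cellFun k K) (T.Vcell k univ) := by
  refine ⟨?_, by rw [Vcell, image_univ]⟩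
  rw [Fintype.linearIndependent_iff]
  intro c hc K
  obtain ⟨x, hx, hx0⟩ := T.exists_cellShape_ne_zero hd hk K
  have h := T.isRestriction_cellSum k c K
  rw [hc] at h
  have := (isRestriction_zero K.1).unique hreg h hx
  rw [Pi.smul_apply, smul_eq_mul, Pi.zero_apply, eq_comm, mul_eq_zero] at this
  exact this.resolve_right hx0

/-- For k = 1 one has f(s) = 1 - ds, and the d + 1 barycentric coordinates sum to 1, so the simplex
functions are zero. -/
theorem Vcell_one (hd : 2 ≤ d) : T.Vcell 1 univ = ⊥ := by
  have hd0 : (d : ℝ) ≠ 0 := by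
    have : d ≠ 0 := by omega
    exact_mod_cast this
  have h0 (K : T.cells) (x : Euc d) : T.cellShape 1 K x = 0 := by
    rw [cellShape_eq]
    simp only [jac_degree_one hd, Finset.sum_sub_distrib, ← Finset.mul_sum, T.sum_baryAff K x,
      Finset.sum_const, T.card_eq K.1 K.2, nsmul_eq_mul]
    push_cast
    ring
  rw [Vcell, Submodule.span_eq_bot]
  rintro _ ⟨K, -, rfl⟩
  refine T.eq_of_forall_isRestriction fun K' => ⟨0, ?_, isRestriction_zero K'.1⟩
  classical
  refine (T.isRestriction_cellFun 1 K K').congr fun x _ => ?_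
  split_ifs
  · exact h0 K' x
  · rfl

/-! ### The conforming functions in the span of the non-conforming functions -/

/-- The function `1 - P_k^{(0,d-2)}(1 - 2 φ_z)` of the hat function `φ_z`. -/
noncomputable def psi (k : ℕ) (z x : Euc d) : ℝ := 1 - jac d k (T.hat z x)

open Classical in
/-- The sum of the facet functions of the facets that contain `z`. -/
noncomputable def psiL2 (k : ℕ) (z : Euc d) : L2 Ω :=
  ∑ F ∈ T.facets, (if z ∈ F then (1 : ℝ) else 0) • T.facetFun k F

theorem psi_eq (k : ℕ) {K : T.cells} (z : Euc d) {x : Euc d}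
    (hx : x ∈ convexHull ℝ (K.1 : Set (Euc d))) :
    T.psi k z x = 1 - jac d k (T.baryAff K z x) := by
  rw [psi, T.hat_eq hx]

theorem psi_eq_zero (hd : 2 ≤ d) (k : ℕ) {z x : Euc d} (h : T.hat z x = 0) : T.psi k z x = 0 := by
  rw [psi, h, jac_zero hd, sub_self]

theorem psi_eq_zero_of_notMem (hd : 2 ≤ d) (k : ℕ) {K : T.cells} {z x : Euc d} (hz : z ∉ K.1)
    (hx : x ∈ convexHull ℝ (K.1 : Set (Euc d))) : T.psi k z x = 0 :=
  T.psi_eq_zero hd k (by rw [T.hat_eq hx, T.baryAff_of_notMem K hz])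

theorem continuousOn_psi (k : ℕ) (z : Euc d) : ContinuousOn (T.psi k z) (closure Ω) :=
  continuousOn_const.sub ((continuous_jac d k).comp_continuousOn (T.continuousOn_hat z))

theorem isPolyFun_psi (k : ℕ) (z : Euc d) (K : T.cells) :
    ∃ g, IsPolyFun k g ∧ EqOn (T.psi k z) g (convexHull ℝ (K.1 : Set (Euc d))) := by
  refine ⟨_, (IsPolyFun.const k (1 : ℝ)).add
    ((IsPolyFun.jac_affine k (T.baryAff K z)).const_smul (-1)), fun x hx => ?_⟩
  rw [T.psi_eq k z hx]
  simp
  ring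

/-- On a cell containing z the facets through z are those opposite to the other d vertices. Their
functions add up to the sum of f(λ_y) over y ≠ z, minus d B_K. Since d B_K = -1 + Σ_y f(λ_y), what
remains is 1 - f(λ_z). -/
theorem isRestriction_psiL2 (hd : 2 ≤ d) (k : ℕ) (z : Euc d) (K : T.cells) :
    IsRestriction (T.psiL2 k z) K.1 (T.psi k z) := by
  classical
  have hd0 : (d : ℝ) ≠ 0 := by
    have : d ≠ 0 := by omega
    exact_mod_cast this
  refine (T.isRestriction_facetSum k (fun F => if z ∈ F then (1 : ℝ) else 0) K).congr
    fun x hx => ?_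
  by_cases hz : z ∈ K.1
  · simp only
    rw [T.psi_eq k z hx, T.sum_eq_add_sum_erase hz, if_neg (Finset.notMem_erase z K.1), zero_mul,
      zero_add, Finset.sum_congr rfl (g := fun y => jac d k (T.baryAff K y x) - T.cellShape k K x)
      (fun y hy => by
        rw [if_pos (Finset.mem_erase.2 ⟨(Finset.ne_of_mem_erase hy).symm, hz⟩), one_mul]),
      Finset.sum_sub_distrib, Finset.sum_const, Finset.card_erase_of_mem hz, T.card_eq K.1 K.2,
      Nat.add_sub_cancel, nsmul_eq_mul, cellShape_eq, T.sum_eq_add_sum_erase hz]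
    field_simp
    ring
  · rw [T.psi_eq_zero_of_notMem hd k hz hx]
    refine Finset.sum_eq_zero fun y _ => ?_
    rw [if_neg fun h => hz (Finset.mem_of_mem_erase h), zero_mul]

theorem isConformingRep_psi (hd : 2 ≤ d) (k : ℕ) (z : Euc d) :
    T.IsConformingRep k (T.psiL2 k z) (T.psi k z) :=
  T.isConformingRep_of_forall_isRestriction (T.continuousOn_psi k z)
    (fun K => T.isRestriction_psiL2 hd k z K) (T.isPolyFun_psi k z)

theorem IsConformingRep.sum {T : SimplicialMesh Ω} {k : ℕ} {ι : Type*} (s : Finset ι)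
    {v : ι → L2 Ω} {u : ι → Euc d → ℝ} (h : ∀ i ∈ s, T.IsConformingRep k (v i) (u i)) :
    T.IsConformingRep k (∑ i ∈ s, v i) (∑ i ∈ s, u i) := by
  classical
  induction s using Finset.induction_on with
  | empty => simpa using T.isConformingRep_zero k
  | insert i s hi ih =>
    rw [Finset.sum_insert hi, Finset.sum_insert hi]
    exact (h i (Finset.mem_insert_self i s)).add
      (ih fun j hj => h j (Finset.mem_insert_of_mem hj))

theorem conformingVanishing_mono (k : ℕ) {Z Z' : Set (Euc d)} (h : Z ⊆ Z') :
    T.conformingVanishing k Z' ≤ T.conformingVanishing k Z := by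
  rintro v ⟨u, hu, hu0⟩
  exact ⟨u, hu, fun x hx => hu0 x (h hx)⟩

/-- The decomposition of a conforming function into a part that vanishes at the vertices and a
combination of facet functions. -/
theorem conformingVanishing_le_sup_Vfacet (hd : 2 ≤ d) {k : ℕ} (hJ : jac d k 1 ≠ 1)
    {Z : Set (Euc d)} {A : Finset (Finset (Euc d))}
    (hZ : ∀ z ∈ T.vertices, z ∉ Z → (∀ x ∈ Z, T.hat z x = 0) ∧ ∀ F ∈ T.facets, z ∈ F → F ∈ A) :
    T.conformingVanishing k Z ≤
      T.conformingVanishing k (Z ∪ (T.vertices : Set (Euc d))) ⊔ T.Vfacet k A := by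
  classical
  rintro v ⟨u, hu, hu0⟩
  have hJ' : 1 - jac d k 1 ≠ 0 := sub_ne_zero.2 hJ.symm
  -- At the vertices, `psi k z` is 1 - J at z and 0 elsewhere, so with these coefficients w takes
  -- the vertex values of u.
  let w : L2 Ω := ∑ z ∈ T.vertices, (u z / (1 - jac d k 1)) • T.psiL2 k z
  let g : Euc d → ℝ := ∑ z ∈ T.vertices, (u z / (1 - jac d k 1)) • T.psi k z
  have hw : T.IsConformingRep k w g :=
    IsConformingRep.sum _ fun z _ => (T.isConformingRep_psi hd k z).smul _
  have hg (x : Euc d) : g x = ∑ z ∈ T.vertices, (u z / (1 - jac d k 1)) * T.psi k z x := by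
    simp [g]
  have e : v = (v + (-1 : ℝ) • w) + w := by simp
  rw [e]
  refine Submodule.add_mem_sup ⟨_, hu.add (hw.smul (-1)), ?_⟩ ?_
  · intro x hx
    rw [Pi.add_apply, Pi.smul_apply, hg]
    rcases hx with hx | hx
    · rw [hu0 x hx, Finset.sum_eq_zero fun z hz => ?_]
      · simp
      · by_cases hzZ : z ∈ Z
        · rw [hu0 z hzZ, zero_div, zero_mul]
        · rw [T.psi_eq_zero hd k ((hZ z hz hzZ).1 x hx), mul_zero]
    · rw [Finset.sum_eq_single_of_mem x hx fun z _ hzx => by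
        rw [T.psi_eq_zero hd k (by rw [T.hat_vertex hx, if_neg hzx.symm]), mul_zero],
        psi, T.hat_vertex hx, if_pos rfl, div_mul_cancel₀ _ hJ']
      simp
  · refine Submodule.sum_mem _ fun z hz => ?_
    by_cases hzZ : z ∈ Z
    · rw [hu0 z hzZ, zero_div, zero_smul]
      exact zero_mem _
    · refine Submodule.smul_mem _ _ (T.facetSum_mem_Vfacet fun F hF hFA => if_neg fun hzF => ?_)
      exact hFA ((hZ z hz hzZ).2 F hF hzF)

/-- The sum of all simplex functions is conforming. -/
theorem sum_cellFun_mem_S (hd : 2 ≤ d) (k : ℕ) : ∑ K, T.cellFun k K ∈ T.S k := by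
  have hd0 : (d : ℝ) ≠ 0 := by
    have : d ≠ 0 := by omega
    exact_mod_cast this
  -- On a cell only its d + 1 vertices contribute, and 1 - (1/d)((d+1) - Σ_z f(λ_z)) is the simplex
  -- function.
  refine ⟨fun x => 1 - 1 / d * ∑ z ∈ T.vertices, T.psi k z x,
    T.isConformingRep_of_forall_isRestriction ?_ (fun K => ?_) fun K => ?_, by simp⟩
  · exact continuousOn_const.sub (continuousOn_const.mul
      (continuousOn_finsetSum _ fun z _ => T.continuousOn_psi k z))
  · have h := T.isRestriction_cellSum k (fun _ => 1) K
    simp only [one_smul] at h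
    refine h.congr fun x hx => ?_
    classical
    have hsub : K.1 ⊆ T.vertices := fun z hz => Finset.mem_biUnion.2 ⟨K.1, K.2, hz⟩
    rw [← Finset.sum_subset hsub fun z _ hz => T.psi_eq_zero_of_notMem hd k hz hx,
      Finset.sum_congr rfl fun z _ => T.psi_eq k z hx, Finset.sum_sub_distrib, Finset.sum_const,
      T.card_eq K.1 K.2, cellShape_eq, nsmul_eq_mul]
    push_cast
    field_simp
    ring
  · choose g hg hg' using fun z => T.isPolyFun_psi k z K
    refine ⟨_, (IsPolyFun.const k (1 : ℝ)).add ((IsPolyFun.sum T.vertices g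
      fun z _ => hg z).const_smul (-(1 / d : ℝ))), fun x hx => ?_⟩
    simp only [Pi.add_apply, Pi.smul_apply, smul_eq_mul]
    rw [Finset.sum_congr rfl fun z _ => hg' z hx]
    ring

/-! ### Traces on facets and membership in the maximal spaces. -/

/-- On every facet `F` of a cell the restriction of `v` to the cell is the sum of a function `W F`
that does not depend on the cell and a combination of Jacobi polynomials in the barycentric
coordinates of `F`. -/
def HasFacetTraces (k : ℕ) (v : L2 Ω) (W : Finset (Euc d) → Euc d → ℝ) : Prop :=
  ∀ K : T.cells, ∃ g, IsPolyFun k g ∧ IsRestriction v K.1 g ∧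
    ∀ F ⊆ K.1, F.card = d → ∃ c : Euc d → ℝ,
      EqOn g (fun x => W F x + ∑ z ∈ F, c z * jac d k (T.baryAff K z x))
        (convexHull ℝ (F : Set (Euc d)))

variable {T} in
theorem HasFacetTraces.add {k : ℕ} {v v' : L2 Ω} {W W' : Finset (Euc d) → Euc d → ℝ}
    (h : T.HasFacetTraces k v W) (h' : T.HasFacetTraces k v' W') :
    T.HasFacetTraces k (v + v') (W + W') := by
  intro K
  obtain ⟨g, hp, hg, hF⟩ := h K
  obtain ⟨g', hp', hg', hF'⟩ := h' K
  refine ⟨g + g', hp.add hp', hg.add hg', fun F hFK hc => ?_⟩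
  obtain ⟨c, hc1⟩ := hF F hFK hc
  obtain ⟨c', hc2⟩ := hF' F hFK hc
  refine ⟨c + c', fun x hx => ?_⟩
  simp only [Pi.add_apply, hc1 hx, hc2 hx, add_mul, Finset.sum_add_distrib]
  ring

variable {T} in
theorem IsConformingRep.hasFacetTraces {k : ℕ} {v : L2 Ω} {u : Euc d → ℝ}
    (hu : T.IsConformingRep k v u) : T.HasFacetTraces k v fun _ => u := by
  intro K
  obtain ⟨p, hp, hpu⟩ := hu.2.2 K.1 K.2
  refine ⟨polyFun p, ⟨p, hp, rfl⟩, (hu.isRestriction K).congr hpu, fun F hFK _ => ⟨0, fun x hx => ?_⟩⟩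
  rw [← hpu (convexHull_mono (Finset.coe_subset.2 hFK) hx)]
  simp

/-- The trace of the simplex function on a facet. -/
theorem cellShape_eq_of_mem_facet (hd : 2 ≤ d) (k : ℕ) {K : T.cells} {F : Finset (Euc d)}
    (hFK : F ⊆ K.1) (hF : F.card = d) {x : Euc d} (hx : x ∈ convexHull ℝ (F : Set (Euc d))) :
    T.cellShape k K x = 1 / d * ∑ z ∈ F, jac d k (T.baryAff K z x) := by
  classical
  obtain ⟨z, hz, rfl⟩ := T.exists_eq_erase hF hFK
  rw [cellShape_eq, T.sum_eq_add_sum_erase hz,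
    T.baryAff_eq_zero_of_mem_facet hFK (Finset.notMem_erase z K.1) hx, jac_zero hd]
  ring

theorem hasFacetTraces_cellSum (hd : 2 ≤ d) (k : ℕ) (c : T.cells → ℝ) :
    T.HasFacetTraces k (∑ K, c K • T.cellFun k K) 0 := by
  intro K
  refine ⟨_, (T.isPolyFun_cellShape k K).const_smul (c K), T.isRestriction_cellSum k c K,
    fun F hFK hF => ⟨fun _ => c K * (1 / d), fun x hx => ?_⟩⟩
  rw [Pi.smul_apply, T.cellShape_eq_of_mem_facet hd k hFK hF hx]
  simp only [Pi.zero_apply, smul_eq_mul, ← Finset.mul_sum]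
  ring

theorem hasFacetTraces_facetSum (hd : 2 ≤ d) (k : ℕ) (a : Finset (Euc d) → ℝ) :
    T.HasFacetTraces k (∑ F ∈ T.facets, a F • T.facetFun k F) fun F _ => a F := by
  classical
  intro K
  refine ⟨_, IsPolyFun.sum K.1 _ fun z _ => ?_, T.isRestriction_facetSum k a K,
    fun F hFK hF => ?_⟩
  · have := ((IsPolyFun.jac_affine k (T.baryAff K z)).add
      ((T.isPolyFun_cellShape k K).const_smul (-1))).const_smul (a (K.1.erase z))
    convert this using 1
    ext x
    simp only [Pi.smul_apply, Pi.add_apply, smul_eq_mul]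
    ring
  · refine ⟨fun z => a (K.1.erase z) - (∑ y ∈ K.1, a (K.1.erase y)) * (1 / d), fun x hx => ?_⟩
    have h := T.cellShape_eq_of_mem_facet hd k hFK hF hx
    obtain ⟨z, hz, rfl⟩ := T.exists_eq_erase hF hFK
    simp only [mul_sub, sub_mul, Finset.sum_sub_distrib, ← Finset.sum_mul, ← Finset.mul_sum]
    rw [T.sum_eq_add_sum_erase hz fun y => a (K.1.erase y) * jac d k (T.baryAff K y x),
      T.baryAff_eq_zero_of_mem_facet hFK (Finset.notMem_erase z K.1) hx, jac_zero hd, h]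
    ring

theorem card_of_mem_facets {F : Finset (Euc d)} (hF : F ∈ T.facets) : F.card = d := by
  obtain ⟨-, -, h⟩ := T.mem_facets.1 hF
  exact h

theorem mem_interiorFacets {F : Finset (Euc d)} : F ∈ T.interiorFacets ↔
    F ∈ T.facets ∧ ¬ convexHull ℝ (F : Set (Euc d)) ⊆ frontier Ω := by
  simp [interiorFacets]

theorem mem_boundaryFacets {F : Finset (Euc d)} : F ∈ T.boundaryFacets ↔
    F ∈ T.facets ∧ convexHull ℝ (F : Set (Euc d)) ⊆ frontier Ω := by
  simp [boundaryFacets]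

theorem interiorFacets_subset : T.interiorFacets ⊆ T.facets := fun _ hF =>
  (T.mem_interiorFacets.1 hF).1

theorem facetOrth_sum_jac (hd : 2 ≤ d) (k : ℕ) {K : T.cells} {F : Finset (Euc d)}
    (hFK : F ⊆ K.1) (hF : F.card = d) (c : Euc d → ℝ) :
    FacetOrth k F fun x => ∑ z ∈ F, c z * jac d k (T.baryAff K z x) := by
  refine FacetOrth.sum hd hF F (fun z x => c z * jac d k (T.baryAff K z x)) (fun z _ => ?_)
    fun z hz => ?_
  · exact continuous_const.mul ((continuous_jac d k).comp (T.continuous_baryAff K z))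
  · refine ((T.facetOrth_jacobiBary hd k K hF hFK ⟨z, hFK hz⟩ hz).const_smul (c z)).congr
      fun x _ => ?_
    rw [Pi.smul_apply, jacobiBary_eq, smul_eq_mul]

variable {T} in
-- In the jump the common part W cancels. The barycentric coordinates from the two sides agree on
-- the facet, so a single combination of orthogonal Jacobi functions remains.
theorem HasFacetTraces.mem_CRmax (hd : 2 ≤ d) (hreg : interior (closure Ω) = Ω) {k : ℕ}
    {v : L2 Ω} {W : Finset (Euc d) → Euc d → ℝ} (h : T.HasFacetTraces k v W) :
    v ∈ T.CRmax k := by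
  refine ⟨fun K hK => ?_, fun F hF K hK K' hK' hFK hFK' _ g g' hg hg' => ?_⟩
  · obtain ⟨_, ⟨p, hp, rfl⟩, hg, -⟩ := h ⟨K, hK⟩
    exact ⟨p, hp, hg⟩
  · have hFc := T.card_of_mem_facets (T.interiorFacets_subset hF)
    obtain ⟨p, -, hp, hpF⟩ := h ⟨K, hK⟩
    obtain ⟨p', -, hp', hpF'⟩ := h ⟨K', hK'⟩
    obtain ⟨c, hc⟩ := hpF F hFK hFc
    obtain ⟨c', hc'⟩ := hpF' F hFK' hFc
    refine (T.facetOrth_sum_jac hd k (K := ⟨K, hK⟩) hFK hFc (c - c')).congr fun x hx => ?_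
    have hxK := convexHull_mono (𝕜 := ℝ) (Finset.coe_subset.2 hFK) hx
    have hxK' := convexHull_mono (𝕜 := ℝ) (Finset.coe_subset.2 hFK') hx
    rw [Pi.sub_apply, IsRestriction.unique (K := ⟨K, hK⟩) hreg hg hp hxK,
      IsRestriction.unique (K := ⟨K', hK'⟩) hreg hg' hp' hxK', hc hx, hc' hx]
    simp only [Pi.sub_apply, sub_mul, Finset.sum_sub_distrib,
      T.baryAff_eq (K := ⟨K, hK⟩) (K' := ⟨K', hK'⟩) hxK hxK']
    ring

variable {T} in
theorem HasFacetTraces.mem_CR0max (hd : 2 ≤ d) (hreg : interior (closure Ω) = Ω) {k : ℕ}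
    {v : L2 Ω} {W : Finset (Euc d) → Euc d → ℝ} (h : T.HasFacetTraces k v W)
    (hW : ∀ F ∈ T.boundaryFacets, ∀ x ∈ convexHull ℝ (F : Set (Euc d)), W F x = 0) :
    v ∈ T.CR0max k := by
  refine ⟨h.mem_CRmax hd hreg, fun F hF K hK hFK g hg => ?_⟩
  have hFc := T.card_of_mem_facets (T.mem_boundaryFacets.1 hF).1
  obtain ⟨p, -, hp, hpF⟩ := h ⟨K, hK⟩
  obtain ⟨c, hc⟩ := hpF F hFK hFc
  refine (T.facetOrth_sum_jac hd k (K := ⟨K, hK⟩) hFK hFc c).congr fun x hx => ?_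
  have hxK := convexHull_mono (𝕜 := ℝ) (Finset.coe_subset.2 hFK) hx
  rw [IsRestriction.unique (K := ⟨K, hK⟩) hreg hg hp hxK, hc hx]
  simp only [hW F hF x hx, zero_add]

/-! ### Inclusions and decompositions of the Crouzeix-Raviart spaces. -/

theorem CR_of_even {k : ℕ} (hk : Even k) : T.CR k = T.S k ⊔ T.Vcell k univ := if_pos hk

theorem CR0_of_even {k : ℕ} (hk : Even k) : T.CR0 k = T.S0 k ⊔ T.Vcell k univ := if_pos hk

theorem CR_of_odd {k : ℕ} (hk : Odd k) : T.CR k = T.S k ⊔ T.Vfacet k T.facets :=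
  if_neg (Nat.not_even_iff_odd.2 hk)

theorem CR0_of_odd {k : ℕ} (hk : Odd k) : T.CR0 k = T.S0 k ⊔ T.Vfacet k T.interiorFacets :=
  if_neg (Nat.not_even_iff_odd.2 hk)

theorem S_le_CR (k : ℕ) : T.S k ≤ T.CR k := by
  rcases Nat.even_or_odd k with hk | hk
  · rw [T.CR_of_even hk]; exact le_sup_left
  · rw [T.CR_of_odd hk]; exact le_sup_left

theorem S0_le_CR0 (k : ℕ) : T.S0 k ≤ T.CR0 k := by
  rcases Nat.even_or_odd k with hk | hk
  · rw [T.CR0_of_even hk]; exact le_sup_left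
  · rw [T.CR0_of_odd hk]; exact le_sup_left

theorem CR_subset_CRmax (hd : 2 ≤ d) (hreg : interior (closure Ω) = Ω) (k : ℕ) :
    (T.CR k : Set (L2 Ω)) ⊆ T.CRmax k := by
  intro v hv
  rcases Nat.even_or_odd k with hk | hk
  · rw [T.CR_of_even hk] at hv
    obtain ⟨s, ⟨u, hu, -⟩, w, hw, rfl⟩ := Submodule.mem_sup.1 hv
    obtain ⟨c, -, rfl⟩ := T.exists_coeff_of_mem_Vcell hw
    exact (hu.hasFacetTraces.add (T.hasFacetTraces_cellSum hd k c)).mem_CRmax hd hreg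
  · rw [T.CR_of_odd hk] at hv
    obtain ⟨s, ⟨u, hu, -⟩, w, hw, rfl⟩ := Submodule.mem_sup.1 hv
    obtain ⟨a, -, rfl⟩ := T.exists_coeff_of_mem_Vfacet Finset.Subset.rfl hw
    exact (hu.hasFacetTraces.add (T.hasFacetTraces_facetSum hd k a)).mem_CRmax hd hreg

theorem CR0_subset_CR0max (hd : 2 ≤ d) (hreg : interior (closure Ω) = Ω) (k : ℕ) :
    (T.CR0 k : Set (L2 Ω)) ⊆ T.CR0max k := by
  intro v hv
  rcases Nat.even_or_odd k with hk | hk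
  · rw [T.CR0_of_even hk] at hv
    obtain ⟨s, ⟨u, hu, hu0⟩, w, hw, rfl⟩ := Submodule.mem_sup.1 hv
    obtain ⟨c, -, rfl⟩ := T.exists_coeff_of_mem_Vcell hw
    refine (hu.hasFacetTraces.add (T.hasFacetTraces_cellSum hd k c)).mem_CR0max hd hreg
      fun F hF x hx => ?_
    simp [hu0 x ((T.mem_boundaryFacets.1 hF).2 hx)]
  · rw [T.CR0_of_odd hk] at hv
    obtain ⟨s, ⟨u, hu, hu0⟩, w, hw, rfl⟩ := Submodule.mem_sup.1 hv
    obtain ⟨a, ha, rfl⟩ := T.exists_coeff_of_mem_Vfacet T.interiorFacets_subset hw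
    refine (hu.hasFacetTraces.add (T.hasFacetTraces_facetSum hd k a)).mem_CR0max hd hreg
      fun F hF x hx => ?_
    have h := (T.mem_boundaryFacets.1 hF).2
    simp [hu0 x (h hx), ha F fun hF' => (T.mem_interiorFacets.1 hF').2 h]

theorem CR_eq_Sdot_sup (hd : 2 ≤ d) {k : ℕ} (hk : Odd k) :
    T.CR k = T.Sdot k ⊔ T.Vfacet k T.facets := by
  have hJ : jac d k 1 ≠ 1 := (lt_trans (jac_one_neg hd hk) zero_lt_one).ne
  rw [T.CR_of_odd hk]
  refine le_antisymm (sup_le ?_ le_sup_right) (sup_le_sup_right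
    (T.conformingVanishing_mono k (empty_subset _)) _)
  have := T.conformingVanishing_le_sup_Vfacet hd hJ (Z := ∅) (A := T.facets)
    fun z _ _ => ⟨fun x hx => absurd hx (notMem_empty x), fun F hF _ => hF⟩
  rwa [empty_union] at this

/-- A vertex off the boundary has a hat function that vanishes on the boundary, and all facets
through it are interior. Correcting the vertex values therefore uses interior facets only. -/
theorem CR0_eq_S0dot_sup (hd : 2 ≤ d) (hreg : interior (closure Ω) = Ω) {k : ℕ} (hk : Odd k) :
    T.CR0 k = T.S0dot k ⊔ T.Vfacet k T.interiorFacets := by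
  rw [T.CR0_of_odd hk]
  refine le_antisymm (sup_le ?_ le_sup_right) (sup_le_sup_right
    (T.conformingVanishing_mono k subset_union_left) _)
  refine T.conformingVanishing_le_sup_Vfacet hd (lt_trans (jac_one_neg hd hk) zero_lt_one).ne
    fun z _ hz => ⟨fun x hx => T.hat_eq_zero_of_mem_frontier hreg hz hx, fun F hF hzF => ?_⟩
  exact T.mem_interiorFacets.2 ⟨hF, fun h => hz (h (subset_convexHull ℝ _ hzF))⟩

theorem CR_eq_S_sup_Vcell (hd : 2 ≤ d) {k : ℕ} (hk : Even k) {T' : Set T.cells} {K₀ : T.cells}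
    (hT' : ∀ K, K ≠ K₀ → K ∈ T') : T.CR k = T.S k ⊔ T.Vcell k T' := by
  classical
  rw [T.CR_of_even hk]
  refine le_antisymm (sup_le le_sup_left ?_)
    (sup_le_sup_left (Submodule.span_mono (image_mono (subset_univ _))) _)
  rw [Vcell, Submodule.span_le]
  have hmem (K : T.cells) (hK : K ≠ K₀) : T.cellFun k K ∈ T.Vcell k T' :=
    Submodule.subset_span ⟨K, hT' K hK, rfl⟩
  rintro _ ⟨K, -, rfl⟩
  by_cases hK : K = K₀
  · subst hK
    -- The missing simplex function is the sum of all of them, which is conforming, minus the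
    -- others.
    have e : T.cellFun k K = ∑ K', T.cellFun k K' + -∑ K' ∈ Finset.univ.erase K, T.cellFun k K' := by
      rw [← Finset.add_sum_erase _ _ (Finset.mem_univ K)]
      abel
    rw [e]
    exact Submodule.add_mem_sup (T.sum_cellFun_mem_S hd k)
      (neg_mem (Submodule.sum_mem _ fun K' hK' => hmem K' (Finset.ne_of_mem_erase hK')))
  · exact Submodule.mem_sup_right (hmem K hK)

/-! ### Strictness of the inclusions -/

open Classical in
/-- The values of a facet function at the vertices of an adjacent cell. -/
theorem facetFun_vertex (hd : 2 ≤ d) (hreg : interior (closure Ω) = Ω) (k : ℕ) {K : T.cells}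
    {z : Euc d} (hz : z ∈ K.1) {g : Euc d → ℝ}
    (hg : IsRestriction (T.facetFun k (K.1.erase z)) K.1 g) {y : Euc d} (hy : y ∈ K.1) :
    g y = (1 - jac d k 1) / d * (1 - d * if y = z then 1 else 0) := by
  have h := T.isRestriction_facetSum k (fun F => if F = K.1.erase z then (1 : ℝ) else 0) K
  rw [T.facetSum_single k (T.erase_mem_facets K hz)] at h
  have hinj (y : Euc d) (hy : y ∈ K.1) : K.1.erase y = K.1.erase z ↔ y = z := by
    refine ⟨fun h => ?_, fun h => by rw [h]⟩
    by_contra hne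
    have : y ∈ K.1.erase z := Finset.mem_erase.2 ⟨hne, hy⟩
    rw [← h] at this
    exact Finset.notMem_erase y _ this
  refine (hg.unique hreg h (T.vertex_mem_cell hy)).trans ?_
  rw [T.facetSum_vertex hd k
    (fun F => if F = K.1.erase z then (1 : ℝ) else 0) hy,
    Finset.sum_congr rfl (g := fun y => if y = z then (1 : ℝ) else 0)
      (fun y hy => by simp only [hinj y hy]), Finset.sum_ite_eq', if_pos hz]
  simp only [hinj y hy]

theorem isRestriction_facetFun_of_not_subset (k : ℕ) {F : Finset (Euc d)} {K : T.cells}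
    (h : ¬ F ⊆ K.1) : IsRestriction (T.facetFun k F) K.1 0 := by
  classical
  have := T.isRestriction_facetFun k F K
  rwa [if_neg h] at this

/-- Two different facets of K together contain all its vertices, so a cell containing both is K. -/
theorem not_subset_of_erase_subset [DecidableEq (Euc d)] {K K' : T.cells} (hne : K' ≠ K)
    {y z : Euc d} (hyz : y ≠ z) (h : K.1.erase y ⊆ K'.1) : ¬ K.1.erase z ⊆ K'.1 := by
  intro h'
  refine hne (T.cell_eq_of_subset fun x hx => ?_).symm
  by_cases hxy : x = y
  · exact h' (Finset.mem_erase.2 ⟨fun hxz => hyz (hxy.symm.trans hxz), hx⟩)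
  · exact h (Finset.mem_erase.2 ⟨hxy, hx⟩)

/-- Suppose the function of an interior facet F of K were in S_{k,0}. Another facet of K contains
the vertex z opposite to F. That facet is on the boundary or belongs to a cell on which the function
is zero, so the value at z would be 0; but it is (1-J)(1-d)/d, where J < 0. -/
theorem S0_lt_CR0_of_odd (hd : 2 ≤ d) (hconn : IsConnected Ω)
    (hreg : interior (closure Ω) = Ω) {k : ℕ} (hk : Odd k) (hcard : 2 ≤ T.cells.card) :
    T.S0 k < T.CR0 k := by
  classical
  refine lt_of_le_not_ge (T.S0_le_CR0 k) fun hle => ?_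
  obtain ⟨F, hF⟩ := T.interiorFacets_nonempty hconn hreg hcard
  obtain ⟨K, hFK, hFc⟩ := T.mem_facets.1 (T.interiorFacets_subset hF)
  have hmem : T.facetFun k F ∈ T.CR0 k := by
    rw [T.CR0_of_odd hk]
    exact Submodule.mem_sup_right (Submodule.subset_span ⟨F, hF, rfl⟩)
  obtain ⟨u, hu, hu0⟩ := hle hmem
  obtain ⟨z, hz, rfl⟩ := T.exists_eq_erase hFc hFK
  obtain ⟨y, hy⟩ : (K.1.erase z).Nonempty := Finset.card_pos.1 (by omega)
  have hyK := Finset.mem_of_mem_erase hy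
  have hyz := Finset.ne_of_mem_erase hy
  have hzF' : z ∈ K.1.erase y := Finset.mem_erase.2 ⟨hyz.symm, hz⟩
  have hval : u z = 0 := by
    by_cases hF' : convexHull ℝ ((K.1.erase y : Finset (Euc d)) : Set (Euc d)) ⊆ frontier Ω
    · exact hu0 z (hF' (subset_convexHull ℝ _ hzF'))
    · obtain ⟨K', hK', hsub⟩ := T.exists_other_cell hd hreg
        (T.card_of_mem_facets (T.erase_mem_facets K hyK)) (Finset.erase_subset _ _) hF'
      exact (hu.isRestriction K').unique hreg (T.isRestriction_facetFun_of_not_subset k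
        (T.not_subset_of_erase_subset hK' hyz hsub)) (T.vertex_mem_cell (hsub hzF'))
  rw [T.facetFun_vertex hd hreg k hz (hu.isRestriction K) hz, if_pos rfl] at hval
  have hd2 : (2 : ℝ) ≤ d := by exact_mod_cast hd
  have hJ := jac_one_neg hd hk
  rcases mul_eq_zero.1 hval with h | h
  · rcases div_eq_zero_iff.1 h with h | h <;> linarith
  · linarith

theorem S0_lt_CR0_of_even (hd : 2 ≤ d) (hconn : IsConnected Ω)
    (hreg : interior (closure Ω) = Ω) {k : ℕ} (hk : Even k) : T.S0 k < T.CR0 k := by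
  classical
  refine lt_of_le_not_ge (T.S0_le_CR0 k) fun hle => ?_
  obtain ⟨K⟩ := T.exists_cell hconn
  have hmem : T.cellFun k K ∈ T.CR0 k := by
    rw [T.CR0_of_even hk]
    exact Submodule.mem_sup_right (Submodule.subset_span ⟨K, mem_univ K, rfl⟩)
  have h := hle hmem
  rw [← T.cellSum_single k K] at h
  have hd2 : (2 : ℝ) ≤ d := by exact_mod_cast hd
  have hJ : 0 < (d : ℝ) - 1 + jac d k 1 := by linarith [jac_one_pos hd hk]
  have := T.cellSum_coeff_eq_zero hd hconn hreg hJ.ne' _ h K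
  simp at this

/-- For odd `k` the simplex functions do not belong to `CR_{k,0}`. -/
theorem cellFun_notMem_CR0 (hd : 2 ≤ d) (hreg : interior (closure Ω) = Ω) {k : ℕ} (hk : Odd k)
    (hJ : (d : ℝ) - 1 + jac d k 1 ≠ 0) (K : T.cells) : T.cellFun k K ∉ T.CR0 k := by
  classical
  have hd0 : (d : ℝ) ≠ 0 := by
    have : d ≠ 0 := by omega
    exact_mod_cast this
  intro hmem
  rw [T.CR0_of_odd hk] at hmem
  obtain ⟨s, ⟨u, hu, hu0⟩, w, hw, hsum⟩ := Submodule.mem_sup.1 hmem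
  obtain ⟨a, ha, rfl⟩ := T.exists_coeff_of_mem_Vfacet T.interiorFacets_subset hw
  -- Summing the vertex values over a facet F of K' leaves only the coefficient of F among all the
  -- `a`. The left side depends on F alone, the right side on whether K' is the given cell. For a
  -- facet of K this is contradictory: an interior facet has a second cell, which gives 0 instead of
  -- d-1+J, and on a boundary facet the left side is 0.
  have key (K' : T.cells) (z : Euc d) (hz : z ∈ K'.1) :
      ∑ y ∈ K'.1.erase z, u y + (1 - jac d k 1) * a (K'.1.erase z) =
        if K = K' then (d : ℝ) - 1 + jac d k 1 else 0 := by
    have hy (y : Euc d) (hy : y ∈ K'.1) : u y =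
        (if K = K' then ((d : ℝ) - 1 + jac d k 1) / d else 0) -
          (1 - jac d k 1) / d * (∑ z ∈ K'.1, a (K'.1.erase z) - d * a (K'.1.erase y)) := by
      have h1 := (hu.isRestriction K').add (T.isRestriction_facetSum k a K')
      rw [hsum] at h1
      have h2 := h1.unique hreg (T.isRestriction_cellFun k K K') (T.vertex_mem_cell hy)
      rw [Pi.add_apply, T.facetSum_vertex hd k a hy] at h2
      have h3 : (if K = K' then T.cellShape k K' else 0) y =
          if K = K' then ((d : ℝ) - 1 + jac d k 1) / d else 0 := by
        split_ifs
        · exact T.cellShape_vertex hd k hy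
        · rfl
      rw [h3] at h2
      linarith
    rw [Finset.sum_congr rfl fun y h => hy y (Finset.mem_of_mem_erase h), Finset.sum_sub_distrib,
      Finset.sum_const, ← Finset.mul_sum, Finset.sum_sub_distrib, Finset.sum_const,
      ← Finset.mul_sum, T.card_of_mem_facets (T.erase_mem_facets K' hz),
      T.sum_eq_add_sum_erase hz fun z => a (K'.1.erase z)]
    simp only [nsmul_eq_mul]
    split_ifs <;> field_simp <;> ring
  obtain ⟨z, hz⟩ : K.1.Nonempty := Finset.card_pos.1 (by rw [T.card_eq K.1 K.2]; omega)
  have h1 := key K z hz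
  rw [if_pos rfl] at h1
  by_cases hF : convexHull ℝ ((K.1.erase z : Finset (Euc d)) : Set (Euc d)) ⊆ frontier Ω
  · rw [ha _ fun h => (T.mem_interiorFacets.1 h).2 hF, mul_zero, add_zero,
      Finset.sum_eq_zero fun y hy => hu0 y (hF (subset_convexHull ℝ _ hy))] at h1
    exact hJ h1.symm
  · have hc := T.card_of_mem_facets (T.erase_mem_facets K hz)
    obtain ⟨K', hK', hsub⟩ := T.exists_other_cell hd hreg hc (Finset.erase_subset _ _) hF
    obtain ⟨z', hz', he⟩ := T.exists_eq_erase hc hsub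
    have h2 := key K' z' hz'
    rw [if_neg hK'.symm, ← he, h1] at h2
    exact hJ h2

/-- For even `k` the facet functions do not belong to `CR_{k,0}`. -/
theorem facetFun_notMem_CR0 (hd : 3 ≤ d) (hreg : interior (closure Ω) = Ω) {k : ℕ} (hk : Even k)
    (hJ : jac d k 1 ≠ 1) {F : Finset (Euc d)} (hF : F ∈ T.facets) : T.facetFun k F ∉ T.CR0 k := by
  classical
  have hd' : 2 ≤ d := by omega
  have hd0 : (d : ℝ) ≠ 0 := by
    have : d ≠ 0 := by omega
    exact_mod_cast this
  intro hmem
  rw [T.CR0_of_even hk] at hmem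
  obtain ⟨s, ⟨u, hu, hu0⟩, w, hw, hsum⟩ := Submodule.mem_sup.1 hmem
  obtain ⟨c, -, rfl⟩ := T.exists_coeff_of_mem_Vcell hw
  have hres (K : T.cells) : IsRestriction (T.facetFun k F) K.1 (u + c K • T.cellShape k K) := by
    rw [← hsum]
    exact (hu.isRestriction K).add (T.isRestriction_cellSum k c K)
  obtain ⟨K, hFK, hFc⟩ := T.mem_facets.1 hF
  obtain ⟨z, hz, rfl⟩ := T.exists_eq_erase hFc hFK
  obtain ⟨x, hx, y, hy, hxy⟩ := Finset.one_lt_card.1 (show 1 < (K.1.erase z).card by omega)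
  have hxK := Finset.mem_of_mem_erase hx
  have hyK := Finset.mem_of_mem_erase hy
  have hxz := Finset.ne_of_mem_erase hx
  have hyz := Finset.ne_of_mem_erase hy
  have hzF' : z ∈ K.1.erase y := Finset.mem_erase.2 ⟨hyz.symm, hz⟩
  have hxF' : x ∈ K.1.erase y := Finset.mem_erase.2 ⟨hxy, hxK⟩
  -- The facet opposite to y contains x and z. On a second cell adjacent to it the facet function is
  -- zero, so u is a multiple of a simplex function there, and these have equal values at all
  -- vertices. On K, however, the facet function differs at x and z by 1 - J, and the simplex
  -- function does not account for that.
  have hval : u x = u z := by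
    by_cases hF' : convexHull ℝ ((K.1.erase y : Finset (Euc d)) : Set (Euc d)) ⊆ frontier Ω
    · rw [hu0 z (hF' (subset_convexHull ℝ _ hzF')), hu0 x (hF' (subset_convexHull ℝ _ hxF'))]
    · obtain ⟨K', hK', hsub⟩ := T.exists_other_cell hd' hreg
        (T.card_of_mem_facets (T.erase_mem_facets K hyK)) (Finset.erase_subset _ _) hF'
      have h := (hres K').unique hreg (T.isRestriction_facetFun_of_not_subset k
        (T.not_subset_of_erase_subset hK' hyz hsub))
      have h1 := h (T.vertex_mem_cell (hsub hzF'))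
      have h2 := h (T.vertex_mem_cell (hsub hxF'))
      rw [Pi.add_apply, Pi.smul_apply, T.cellShape_vertex hd' k (hsub hzF')] at h1
      rw [Pi.add_apply, Pi.smul_apply, T.cellShape_vertex hd' k (hsub hxF')] at h2
      exact add_right_cancel (h2.trans h1.symm)
  have h1 := T.facetFun_vertex hd' hreg k hz (hres K) hz
  have h2 := T.facetFun_vertex hd' hreg k hz (hres K) hxK
  rw [Pi.add_apply, Pi.smul_apply, T.cellShape_vertex hd' k hz, if_pos rfl] at h1
  rw [Pi.add_apply, Pi.smul_apply, T.cellShape_vertex hd' k hxK, if_neg hxz, hval, h1] at h2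
  field_simp at h2
  exact hd0 (by linarith)

/-- For even k the witness is the function of an interior facet, for odd k a simplex function. With
J = (-1)^k (k+1) the required conditions read J = k+1 ≠ 1 and 2 + J = 1 - k ≠ 0. -/
theorem CR0_ssubset_CR0max (hd : d = 3) (hconn : IsConnected Ω)
    (hreg : interior (closure Ω) = Ω) {k : ℕ} (hk : 2 ≤ k) (h : Odd k ∨ 2 ≤ T.cells.card) :
    (T.CR0 k : Set (L2 Ω)) ⊂ T.CR0max k := by
  classical
  subst hd
  have hk2 : (2 : ℝ) ≤ k := by exact_mod_cast hk
  rw [ssubset_iff_of_subset (T.CR0_subset_CR0max (by norm_num) hreg k)]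
  rcases Nat.even_or_odd k with he | ho
  · obtain ⟨F, hF⟩ := T.interiorFacets_nonempty hconn hreg
      (h.resolve_left (Nat.not_odd_iff_even.2 he))
    have hF' := T.interiorFacets_subset hF
    refine ⟨T.facetFun k F, ?_, T.facetFun_notMem_CR0 le_rfl hreg he ?_ hF'⟩
    · rw [← T.facetSum_single k hF']
      refine (T.hasFacetTraces_facetSum (by norm_num) k _).mem_CR0max (by norm_num) hreg
        fun F' hF'b _ _ => if_neg ?_
      rintro rfl
      exact (T.mem_interiorFacets.1 hF).2 (T.mem_boundaryFacets.1 hF'b).2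
    · rw [jac_three_one, he.neg_one_pow]
      intro h
      linarith
  · obtain ⟨K⟩ := T.exists_cell hconn
    refine ⟨T.cellFun k K, ?_, T.cellFun_notMem_CR0 (by norm_num) hreg ho ?_ K⟩
    · rw [← T.cellSum_single k K]
      exact (T.hasFacetTraces_cellSum (by norm_num) k _).mem_CR0max (by norm_num) hreg
        fun _ _ _ _ => rfl
    · rw [jac_three_one, ho.neg_one_pow]
      intro h
      push_cast at h
      linarith

end SimplicialMesh

/-! ### The theorem. -/

theorem mainTheorem1 (d : ℕ) (hd : 2 ≤ d) (Ω : Set (Euc d)) (hopen : IsOpen Ω)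
    (hconn : IsConnected Ω) (hreg : interior (closure Ω) = Ω) (T : SimplicialMesh Ω)
    (k : ℕ) (hk : 1 ≤ k) :
    -- the direct sum decompositions
    (Odd k → T.CR k = T.Sdot k ⊔ T.Vfacet k T.facets ∧
      Disjoint (T.Sdot k) (T.Vfacet k T.facets)) ∧
    (Even k → ∀ T' : Finset T.cells, T'.card + 1 = T.cells.card →
      T.CR k = T.S k ⊔ T.Vcell k (T' : Set T.cells) ∧
        Disjoint (T.S k) (T.Vcell k (T' : Set T.cells))) ∧
    (Odd k → T.CR0 k = T.S0dot k ⊔ T.Vfacet k T.interiorFacets ∧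
      Disjoint (T.S0dot k) (T.Vfacet k T.interiorFacets)) ∧
    (Even k → T.CR0 k = T.S0 k ⊔ T.Vcell k Set.univ ∧
      Disjoint (T.S0 k) (T.Vcell k Set.univ)) ∧
    -- bases of the non-conforming parts
    (Odd k → IsBasisOf (fun F : T.facets => T.facetFun k F) (T.Vfacet k T.facets) ∧
      IsBasisOf (fun F : T.interiorFacets => T.facetFun k F)
        (T.Vfacet k T.interiorFacets)) ∧
    (2 ≤ k → IsBasisOf (fun K : T.cells => T.cellFun k K) (T.Vcell k Set.univ)) ∧
    (k = 1 → T.Vcell k Set.univ = ⊥) ∧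
    -- the inclusions
    (T.S k ≤ T.CR k ∧ (T.CR k : Set (L2 Ω)) ⊆ T.CRmax k) ∧
    (T.S0 k ≤ T.CR0 k ∧ (T.CR0 k : Set (L2 Ω)) ⊆ T.CR0max k) ∧
    -- strictness
    (Even k ∨ 2 ≤ T.cells.card → T.S0 k < T.CR0 k) ∧
    (d = 3 → 2 ≤ k → Odd k ∨ 2 ≤ T.cells.card →
      (T.CR0 k : Set (L2 Ω)) ⊂ T.CR0max k) := by
  have hd2 : (2 : ℝ) ≤ d := by exact_mod_cast hd
  have hodd (hk : Odd k) : jac d k 1 ≠ 1 := (lt_trans (jac_one_neg hd hk) zero_lt_one).ne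
  have heven (hk : Even k) : (d : ℝ) - 1 + jac d k 1 ≠ 0 :=
    (show 0 < (d : ℝ) - 1 + jac d k 1 by linarith [jac_one_pos hd hk]).ne'
  refine ⟨fun h => ⟨T.CR_eq_Sdot_sup hd h, T.disjoint_Sdot_Vfacet hd hreg (hodd h)⟩,
    fun h T' hT' => ?_, fun h => ⟨T.CR0_eq_S0dot_sup hd hreg h, ?_⟩,
    fun h => ⟨T.CR0_of_even h, T.disjoint_S0_Vcell hd hconn hreg (heven h)⟩,
    fun h => ⟨T.isBasisOf_facetFun hd hreg (hodd h) Finset.Subset.rfl,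
      T.isBasisOf_facetFun hd hreg (hodd h) T.interiorFacets_subset⟩,
    fun h => T.isBasisOf_cellFun hd hreg h, ?_,
    ⟨T.S_le_CR k, T.CR_subset_CRmax hd hreg k⟩, ⟨T.S0_le_CR0 k, T.CR0_subset_CR0max hd hreg k⟩,
    fun h => ?_, fun h3 h2 h => T.CR0_ssubset_CR0max h3 hconn hreg h2 h⟩
  · classical
    -- The one cell left out serves both purposes: its simplex function is recovered modulo S_k, and
    -- its zero coefficient forces all others to vanish.
    have hc : T'ᶜ.card = 1 := by
      rw [Finset.card_compl, Fintype.card_coe]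
      omega
    obtain ⟨K₀, hK₀⟩ := Finset.card_eq_one.1 hc
    refine ⟨T.CR_eq_S_sup_Vcell hd h (K₀ := K₀) fun K hK => ?_,
      T.disjoint_S_Vcell hd hconn hreg (heven h) (K₀ := K₀) fun hK => ?_⟩
    · by_contra hKT
      exact hK (Finset.mem_singleton.1 (hK₀ ▸ Finset.mem_compl.2 hKT))
    · exact Finset.mem_compl.1 (hK₀ ▸ Finset.mem_singleton_self K₀) hK
  · exact (T.disjoint_Sdot_Vfacet hd hreg (hodd h)).mono
      (T.conformingVanishing_mono k subset_union_right)
      (Submodule.span_mono (image_mono (Finset.coe_subset.2 T.interiorFacets_subset)))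
  · rintro rfl
    exact T.Vcell_one hd
  · rcases Nat.even_or_odd k with he | ho
    · exact T.S0_lt_CR0_of_even hd hconn hreg he
    · exact T.S0_lt_CR0_of_odd hd hconn hreg ho (h.resolve_left (Nat.not_even_iff_odd.2 ho))
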